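/- **Setting.** Consider players $i\in\{1,\dots,N\}$, a horizon $T$, and a known initial state $s_0\in\mathbb R^{n_s}$. Let $w=\mathrm{col}(w_0,\dots,w_{T-1})$, $w_t\in\mathbb R^{n_s}$, be a random vector on a probability space $(\Xi,\mathbb P)$, with expectation $\mathbb E_w$. At time $t\in\{0,\dots,T-1\}$ player $i$ chooses $u^i_t\in\mathcal D^i_t\subset\mathbb R^{n_i}$, where $\mathcal D^i_t$ is nonempty, compact and convex; the state evolves by $s_{t+1}=A_ts_t+\sum_{j=1}^N B^j_tu^j_t+w_t$. Put $u^i=\mathrm{col}(u^i_0,\dots,u^i_{T-1})$, $u=\mathrm{col}(u^1,\dots,u^N)$, $\mathcal D^i=\prod_t\mathcal D^i_t$, $\mathcal D=\prod_i\mathcal D^i$, and let $s=s(s_0,u,w)=\mathrm{col}(s_0,\dots,s_T)$ be the resulting state trajectory. The costs are $$J^i(s_0,u,w)=\hat J^i(s)+\tilde J^i(u),\qquad \mathbb J^i(s_0,u)=\mathbb E_w[J^i(s_0,u,w)],$$ and the constraint functions are $\bar\xi^j(s_0,u,w)=\hat\xi^j(s)+\tilde\xi^j(u)$, $j=1,\dots,m$,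 with real-valued $\hat J^i,\hat\xi^j$ on $\mathbb R^{(T+1)n_s}$ and $\tilde J^i,\tilde\xi^j$ on $\mathbb R^{T\sum_kn_k}$. Let $\gamma^j\in(0,1)$, $\beta^j\ge0$, let $h:\mathbb R_{\ge0}\to[0,1]$ be nonincreasing, and let $h^{-1}(\gamma^j)\ge0$ be a point at which $h$ takes the value $\gamma^j$. Put $g^j(s_0,u,w)=\bar\xi^j(s_0,u,w)+h^{-1}(\gamma^j)+\beta^j$, $g=\mathrm{col}(g^1,\dots,g^m)$, and $$\mathcal U(s_0)=\{u\in\mathcal D:\ \mathbb E_w[g^j(s_0,u,w)]\le0,\ j=1,\dots,m\}.$$ **Assumptions.** 1. $J^i(s_0,u,w)$ is integrable for every $i$ and every $u\in\mathbb R^{T\sum_kn_k}$; $\hat J^i$ is convex and differentiable; $\tilde J^i$ is continuous in $u$, and convex and differentiable with respect to $u^i$. 2. $\hat\xi^j$ is convex and differentiable; $\tilde\xi^j$ is differentiable, and convex with respect to each $u^i$. Moreover the under-approximated constraints are convex: each $u\mapsto\mathbb E_w[g^j(s_0,u,w)]$ is a convex function on the convex set $\mathcal U(s_0)$. 3. There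 is a class $\mathcal C$ of integrable functions $\phi:\Xi\to\mathbb R$, containing $\bar\xi^j(s_0,u,\cdot)$ for all $j$ and all $u\in\mathcal D$, such that $\mathbb P\{|\phi-\mathbb E[\phi]|\le\theta\}\ge1-h(\theta)$ for all $\phi\in\mathcal C$ and $\theta\ge0$. 4. Slater's condition: some $\bar u\in\mathcal D$ satisfies $\mathbb E_w[g^j(s_0,\bar u,w)]<0$ for all $j$. There are functions of $w$, integrable with respect to $w$, that are: a Lipschitz constant of $g(s_0,\cdot,w)$ on $\mathcal D$; a bound of $\|g(s_0,\cdot,w)\|$ on $\mathcal U(s_0)$; a bound of $\|\nabla_ug(s_0,\cdot,w)\|$ on $\mathcal U(s_0)$; and, for every $i$ and every $u^{-i}\in\mathcal D^{-i}$, a Lipschitz constant of $J^i(s_0,\cdot,u^{-i},w)$ on $\mathcal D^i$. **Definitions.** Let $\mathbb F(s_0,u)=\mathrm{col}\big(\mathbb E_w[\nabla_{u^i}J^i(s_0,u,w)]\big)_{i=1}^N$, and let $\mathcal N_C(x)=\{v:\langle v,y-x\rangle\le0\ \ \forall y\in C\}$ for $x\in C$, $\mathcal N_C(x)=\emptyset$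 for $x\notin C$. A *v-SGNE* is a $u_\star\in\mathcal U(s_0)$ that is a generalized Nash equilibrium, i.e. $\mathbb J^i(s_0,u_\star)\le\mathbb J^i(s_0,y,u_\star^{-i})$ for all $i$ and all $y\in\mathcal D^i$ with $(y,u_\star^{-i})\in\mathcal U(s_0)$, and that solves the stochastic variational inequality $\langle\mathbb F(s_0,u_\star),u-u_\star\rangle\ge0$ for all $u\in\mathcal U(s_0)$. On $(u,\lambda)\in\mathbb R^{T\sum_kn_k}\times\mathbb R^m$ define the set-valued operators $$\mathcal A(u,\lambda)=\left\{\begin{bmatrix}\mathbb F(s_0,u)+\mathbb E_w[\nabla_ug(s_0,u,w)]\,\lambda\\-\mathbb E_w[g(s_0,u,w)]\end{bmatrix}\right\},\qquad \mathcal B(u,\lambda)=\mathcal N_{\mathcal D}(u)\times\mathcal N_{\mathbb R^m_{\ge0}}(\lambda),$$ where $[\nabla_ug]_{k,j}=\partial g^j/\partial u_k$, and $\mathrm{zer}(\mathcal A+\mathcal B)=\{z:0\in\mathcal A(z)+\mathcal B(z)\}$. **Lemma.** Under Assumptions 1–4, $\mathrm{zer}(\mathcal A+\mathcal B)\neq\emptyset$.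 Moreover there are a v-SGNE $u_\star$ and a multiplier $\bar\lambda\in\mathbb R^m_{\ge0}$ with $(u_\star,\bar\lambda)\in\mathrm{zer}(\mathcal A+\mathcal B)$, so that the KKT inclusions hold: $$0\in\mathbb E_w[\nabla_{u^i}J^i(s_0,u_\star,w)]+\mathcal N_{\mathcal D^i}(u^i_\star)+\mathbb E_w[\nabla_{u^i}g(s_0,u_\star,w)]\,\bar\lambda\quad(i=1,\dots,N),\qquad 0\in-\mathbb E_w[g(s_0,u_\star,w)]+\mathcal N_{\mathbb R^m_{\ge0}}(\bar\lambda).$$ -/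

import Mathlib

open MeasureTheory
open scoped NNReal Pointwise

noncomputable section

/-- `ℝᵏ` with the Euclidean inner product. -/
abbrev Vec (k : ℕ) : Type := EuclideanSpace ℝ (Fin k)

/-- Trajectories `col(x₀, …, x_{T-1})` of vectors of `ℝᵏ`, with the Euclidean inner product. -/
abbrev Traj (T k : ℕ) : Type := PiLp 2 (fun _ : Fin T => Vec k)

/-- Strategy profiles `u = col(u¹, …, uᴺ)`; `u i t` is `uⁱ_t ∈ ℝ^{n i}`. -/
abbrev Profile {N : ℕ} (T : ℕ) (n : Fin N → ℕ) : Type := PiLp 2 (fun i : Fin N => Traj T (n i))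

/-- The profile `(x, u⁻ⁱ)`: player `i` plays `x`, the others play as in `u`. -/
def Profile.deviate {N T : ℕ} {n : Fin N → ℕ} (u : Profile T n) (i : Fin N) (x : Traj T (n i)) :
    Profile T n :=
  WithLp.toLp 2 (Function.update (fun k => u k) i x)

/-- The normal cone `N_U(x)`, empty for `x ∉ U`. -/
def normalConeAt {E : Type*} [NormedAddCommGroup E] [InnerProductSpace ℝ E] (U : Set E) (x : E) :
    Set E :=
  {v | x ∈ U ∧ ∀ y ∈ U, inner ℝ v (y - x) ≤ 0}

/-- The zero set of a set-valued operator. -/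
def zer {X Y : Type*} [Zero Y] (M : X → Set Y) : Set X := {x | (0 : Y) ∈ M x}

/-- The nonnegative orthant of `ℝᵐ`. -/
def nonnegOrthant (m : ℕ) : Set (Vec m) := {l | ∀ j, 0 ≤ l j}

/-- The data of a stochastic generalized dynamic game with `N` players, horizon `T`, state space
`ℝ^{ns}`, action spaces `ℝ^{n i}` and `m` coupling chance constraints, whose disturbance `w` is a
random vector on the probability space `(Ξ, ℙ)`, together with the data (`h`, its class of
functions `cls`, the value `hInv j = h⁻¹(γʲ)`, and the tightening `β`) of the under-approximation. -/
structure DynGame (N T ns m : ℕ) (n : Fin N → ℕ) (Ξ : Type*) [MeasurableSpace Ξ] where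
  A : Fin T → Matrix (Fin ns) (Fin ns) ℝ
  B : (i : Fin N) → Fin T → Matrix (Fin ns) (Fin (n i)) ℝ
  actions : (i : Fin N) → Fin T → Set (Vec (n i))
  actions_nonempty : ∀ i t, (actions i t).Nonempty
  actions_compact : ∀ i t, IsCompact (actions i t)
  actions_convex : ∀ i t, Convex ℝ (actions i t)
  ℙ : Measure Ξ
  isProbability : IsProbabilityMeasure ℙ
  w : Ξ → Traj T ns
  measurable_w : Measurable w
  /-- the part of the cost that depends on the state trajectory -/
  JHat : Fin N → Traj (T + 1) ns → ℝ
  /-- the part of the cost that depends on the strategies -/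
  JTilde : Fin N → Profile T n → ℝ
  /-- the part of the constraint function that depends on the state trajectory -/
  xiHat : Fin m → Traj (T + 1) ns → ℝ
  /-- the part of the constraint function that depends on the strategies -/
  xiTilde : Fin m → Profile T n → ℝ
  γ : Fin m → ℝ
  γ_mem : ∀ j, γ j ∈ Set.Ioo (0 : ℝ) 1
  cls : Set (Ξ → ℝ)
  h : ℝ≥0 → ℝ
  h_mem : ∀ θ, h θ ∈ Set.Icc (0 : ℝ) 1
  h_antitone : Antitone h
  hInv : Fin m → ℝ≥0
  h_hInv : ∀ j, h (hInv j) = γ j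
  β : Fin m → ℝ
  β_nonneg : ∀ j, 0 ≤ β j

namespace DynGame

variable {N T ns m : ℕ} {n : Fin N → ℕ} {Ξ : Type*} [MeasurableSpace Ξ]
variable (G : DynGame N T ns m n Ξ)

/-- `Dⁱ = ∏ₜ Dⁱ_t`. -/
def strategies (i : Fin N) : Set (Traj T (n i)) := {x | ∀ t, x t ∈ G.actions i t}

/-- `D = ∏ᵢ Dⁱ`. -/
def profiles : Set (Profile T n) := {u | ∀ i, u i ∈ G.strategies i}

/-- The state trajectory `s = col(s₀, …, s_T)`, where
`s_{t+1} = A_t s_t + ∑ⱼ Bʲ_t uʲ_t + w_t`. -/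
def state (s₀ : Vec ns) (u : Profile T n) (ω : Ξ) : Traj (T + 1) ns :=
  WithLp.toLp 2 (fun t : Fin (T + 1) =>
    Fin.induction (motive := fun _ => Vec ns) s₀
      (fun (t : Fin T) (s : Vec ns) =>
        Matrix.toEuclideanLin (G.A t) s + ∑ j, Matrix.toEuclideanLin (G.B j t) (u j t)
          + G.w ω t) t)

/-- `Jⁱ(s₀, u, w)`. -/
def J (i : Fin N) (s₀ : Vec ns) (u : Profile T n) (ω : Ξ) : ℝ :=
  G.JHat i (G.state s₀ u ω) + G.JTilde i u

/-- The expected cost of player `i`. -/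
def expCost (i : Fin N) (s₀ : Vec ns) (u : Profile T n) : ℝ := ∫ ω, G.J i s₀ u ω ∂G.ℙ

/-- `ξ̄ʲ(s₀, u, w)`. -/
def xiBar (j : Fin m) (s₀ : Vec ns) (u : Profile T n) (ω : Ξ) : ℝ :=
  G.xiHat j (G.state s₀ u ω) + G.xiTilde j u

/-- `g(s₀, u, w) = ξ̄(s₀, u, w) + h⁻¹(γ) + β`. -/
def g (s₀ : Vec ns) (u : Profile T n) (ω : Ξ) : Vec m :=
  WithLp.toLp 2 (fun j => G.xiBar j s₀ u ω + (G.hInv j : ℝ) + G.β j)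

/-- `E[g(s₀, u, w)]`. -/
def expG (s₀ : Vec ns) (u : Profile T n) : Vec m := ∫ ω, G.g s₀ u ω ∂G.ℙ

/-- The feasible set `{u ∈ D | E[g(s₀, u, w)] ≤ 0}` of the under-approximated game. -/
def feasible (s₀ : Vec ns) : Set (Profile T n) :=
  {u | u ∈ G.profiles ∧ ∀ j, G.expG s₀ u j ≤ 0}

/-- A stochastic generalized Nash equilibrium of the under-approximated game. -/
def IsSGNE (s₀ : Vec ns) (u : Profile T n) : Prop :=
  u ∈ G.feasible s₀ ∧
    ∀ i, ∀ y ∈ G.strategies i, u.deviate i y ∈ G.feasible s₀ →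
      G.expCost i s₀ u ≤ G.expCost i s₀ (u.deviate i y)

/-- `E[∇_{uⁱ} Jⁱ(s₀, u, w)]`. -/
def expGradJ (i : Fin N) (s₀ : Vec ns) (u : Profile T n) : Traj T (n i) :=
  ∫ ω, gradient (fun x : Traj T (n i) => G.J i s₀ (u.deviate i x) ω) (u i) ∂G.ℙ

/-- The pseudo-gradient mapping `F(s₀, u)`. -/
def pseudoGradient (s₀ : Vec ns) (u : Profile T n) : Profile T n :=
  WithLp.toLp 2 (fun i => G.expGradJ i s₀ u)

/-- `E[∇_{uⁱ} g(s₀, u, w)] λ`, the combination with weights `λʲ` of the columns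
`E[∇_{uⁱ} gʲ(s₀, u, w)]`. -/
def expGradGMul (i : Fin N) (s₀ : Vec ns) (u : Profile T n) (lam : Vec m) : Traj T (n i) :=
  ∑ j, lam j •
    ∫ ω, gradient (fun x : Traj T (n i) => G.g s₀ (u.deviate i x) ω j) (u i) ∂G.ℙ

/-- The solutions of the stochastic variational inequality `SVI(U(s₀), F(s₀, ·))`. -/
def IsSVISolution (s₀ : Vec ns) (u : Profile T n) : Prop :=
  u ∈ G.feasible s₀ ∧ ∀ v ∈ G.feasible s₀, 0 ≤ inner ℝ (G.pseudoGradient s₀ u) (v - u)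

/-- A variational SGNE: an SGNE that also solves the stochastic variational inequality. -/
def IsVariationalSGNE (s₀ : Vec ns) (u : Profile T n) : Prop :=
  G.IsSGNE s₀ u ∧ G.IsSVISolution s₀ u

/-- The KKT inclusions, for all players, of the stochastic variational inequality. -/
def IsKKT (s₀ : Vec ns) (u : Profile T n) (lam : Vec m) : Prop :=
  (∀ i, (0 : Traj T (n i)) ∈
    {G.expGradJ i s₀ u} + normalConeAt (G.strategies i) (u i) + {G.expGradGMul i s₀ u lam}) ∧
  (0 : Vec m) ∈ {-G.expG s₀ u} + normalConeAt (nonnegOrthant m) lam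

/-- The operator
`𝒜 : (u, λ) ↦ (F(s₀, u), 0) + (E[∇_u g(s₀, u, w)] λ, -E[g(s₀, u, w)])`. -/
def opA (s₀ : Vec ns) : Profile T n × Vec m → Set (Profile T n × Vec m) :=
  fun z => {(G.pseudoGradient s₀ z.1, 0) +
    (WithLp.toLp 2 (fun i => G.expGradGMul i s₀ z.1 z.2), -G.expG s₀ z.1)}

/-- The operator `ℬ : (u, λ) ↦ N_D(u) × N_{ℝᵐ≥0}(λ)`. -/
def opB : Profile T n × Vec m → Set (Profile T n × Vec m) :=
  fun z => normalConeAt G.profiles z.1 ×ˢ normalConeAt (nonnegOrthant m) z.2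

/-- The costs: `E[Jⁱ]` is well defined, `Ĵⁱ` is convex and differentiable, `J̃ⁱ` is continuous and
is convex and differentiable with respect to `uⁱ`. -/
structure CostAssumption (s₀ : Vec ns) : Prop where
  wellDefined : ∀ i u, Integrable (G.J i s₀ u) G.ℙ
  hat_convex : ∀ i, ConvexOn ℝ Set.univ (G.JHat i)
  hat_differentiable : ∀ i, Differentiable ℝ (G.JHat i)
  tilde_continuous : ∀ i, Continuous (G.JTilde i)
  tilde_convex : ∀ i (u : Profile T n),
    ConvexOn ℝ Set.univ (fun x : Traj T (n i) => G.JTilde i (u.deviate i x))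
  tilde_differentiable : ∀ i (u : Profile T n),
    Differentiable ℝ (fun x : Traj T (n i) => G.JTilde i (u.deviate i x))

/-- The constraints: `ξ̂ʲ` is convex and differentiable, `ξ̃ʲ` is differentiable and is convex with
respect to each `uⁱ`; the under-approximated constraint is a convex one: `u ↦ E[gʲ(s₀, u, w)]` is a
convex function on the (convex) feasible set. -/
structure ConstraintAssumption (s₀ : Vec ns) : Prop where
  hat_convex : ∀ j, ConvexOn ℝ Set.univ (G.xiHat j)
  hat_differentiable : ∀ j, Differentiable ℝ (G.xiHat j)
  tilde_convex : ∀ j i (u : Profile T n),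
    ConvexOn ℝ Set.univ (fun x : Traj T (n i) => G.xiTilde j (u.deviate i x))
  tilde_differentiable : ∀ j, Differentiable ℝ (G.xiTilde j)
  expG_convex : ∀ j, ConvexOn ℝ (G.feasible s₀) (fun u => G.expG s₀ u j)

/-- Concentration of measure for the functions of the class `cls`, which contains the constraint
functions. -/
structure ConcentrationAssumption (s₀ : Vec ns) : Prop where
  integrable : ∀ φ ∈ G.cls, Integrable φ G.ℙ
  concentration : ∀ φ ∈ G.cls, ∀ θ : ℝ≥0,
    1 - G.h θ ≤ G.ℙ.real {ω | |φ ω - ∫ ω', φ ω' ∂G.ℙ| ≤ θ}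
  xiBar_mem : ∀ j, ∀ u ∈ G.profiles, G.xiBar j s₀ u ∈ G.cls

/-- Slater's constraint qualification, and Lipschitz continuity and boundedness with integrable
constants. -/
structure RegularityAssumption (s₀ : Vec ns) : Prop where
  slater : ∃ u ∈ G.profiles, ∀ j, G.expG s₀ u j < 0
  g_lipschitz : ∃ ℓ : Ξ → ℝ, Integrable ℓ G.ℙ ∧
    ∀ ω, ∀ u ∈ G.profiles, ∀ v ∈ G.profiles, ‖G.g s₀ u ω - G.g s₀ v ω‖ ≤ ℓ ω * ‖u - v‖
  g_bounded : ∃ b : Ξ → ℝ, Integrable b G.ℙ ∧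
    ∀ ω, ∀ u ∈ G.feasible s₀, ‖G.g s₀ u ω‖ ≤ b ω
  gradient_g_bounded : ∃ b : Ξ → ℝ, Integrable b G.ℙ ∧
    ∀ ω, ∀ u ∈ G.feasible s₀, ‖fderiv ℝ (fun v => G.g s₀ v ω) u‖ ≤ b ω
  J_lipschitz : ∀ i, ∀ u ∈ G.profiles, ∃ ℓ : Ξ → ℝ, Integrable ℓ G.ℙ ∧
    ∀ ω, ∀ x ∈ G.strategies i, ∀ y ∈ G.strategies i,
      |G.J i s₀ (u.deviate i x) ω - G.J i s₀ (u.deviate i y) ω| ≤ ℓ ω * ‖x - y‖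

end DynGame

end

noncomputable section

/-! The proof solves the variational inequality first, then extracts multipliers from the solution.

Let Φ(u, v) = ∑ᵢ 𝕁ⁱ(vⁱ, u⁻ⁱ). It is jointly continuous and convex in `v`, and the feasible set is
compact and convex, so the Ky Fan inequality `exists_mem_forall_le_of_convexOn` gives a feasible `u`
minimizing Φ(u, ·) there. The first-order condition of this minimization is the variational
inequality (`exists_isSVISolution`), and convexity of each 𝕁ⁱ in the player's own strategy makes its
solutions equilibria. Ky Fan's inequality comes from Brouwer's theorem, applied to the minimizer of
a strictly convex regularization of Φ; Brouwer's theorem is proved by the volume-polynomial argument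
of Milnor and Rogers.

For the multipliers, linearize at `u`. A direction in which every active constraint strictly
decreases stays feasible for a short time, so the variational inequality makes the linearized
objective nonnegative there. Slater's point is such a direction by convexity. Separation of convex
sets then gives the multipliers (`exists_multipliers_of_linearized`, `exists_multipliers`), and the
resulting inequality on the whole strategy set is the normal cone inclusion.

The calculus only needs one-sided directional derivatives of expectations
(`tendsto_slope_integral`). The difference quotients are dominated through convexity for the costs,
and through the integrable Lipschitz constant for the constraints. -/

/-! ### Brouwer's fixed point theorem. -/

/-- In a basis the entries of the matrix are affine in `t`. The degree bound is what lets finitely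
many small values of `t` determine the value at `t = 1`. -/
theorem ContinuousLinearMap.exists_polynomial_eval_eq_det_one_add_smul {E : Type*}
    [NormedAddCommGroup E] [NormedSpace ℝ E] [FiniteDimensional ℝ E] (A : E →L[ℝ] E) :
    ∃ q : Polynomial ℝ, q.natDegree ≤ Module.finrank ℝ E ∧
      ∀ t : ℝ, q.eval t = (ContinuousLinearMap.id ℝ E + t • A).det := by
  classical
  let b := Module.finBasis ℝ E
  let M := LinearMap.toMatrix b b (A : E →ₗ[ℝ] E)
  refine ⟨Matrix.det ((Polynomial.X : Polynomial ℝ) • M.map Polynomial.C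
    + (1 : Matrix _ _ ℝ).map Polynomial.C), ?_, fun t => ?_⟩
  · simpa using Polynomial.natDegree_det_X_add_C_le M 1
  · rw [← Polynomial.coe_evalRingHom, RingHom.map_det, ContinuousLinearMap.det,
      ← LinearMap.det_toMatrix b]
    congr 1
    ext i j
    by_cases hij : i = j
    · subst hij
      simp [M, LinearMap.toMatrix_apply, add_comm]
      ring
    · simp [M, LinearMap.toMatrix_apply, hij]
      ring

/-- Lagrange interpolation of the polynomial `t ↦ det (1 + t A)`. -/
theorem ContinuousLinearMap.det_id_add_eq_sum_basis {E : Type*}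
    [NormedAddCommGroup E] [NormedSpace ℝ E] [FiniteDimensional ℝ E] {v : ℕ → ℝ}
    (hv : Function.Injective v) (A : E →L[ℝ] E) :
    (ContinuousLinearMap.id ℝ E + A).det =
      ∑ i ∈ Finset.range (Module.finrank ℝ E + 1),
        (Lagrange.basis (Finset.range (Module.finrank ℝ E + 1)) v i).eval 1 *
          (ContinuousLinearMap.id ℝ E + v i • A).det := by
  obtain ⟨q, hq, h⟩ := A.exists_polynomial_eval_eq_det_one_add_smul
  have hdeg : q.degree < (Finset.range (Module.finrank ℝ E + 1)).card := by
    rw [Finset.card_range]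
    exact lt_of_le_of_lt Polynomial.degree_le_natDegree (by exact_mod_cast Nat.lt_succ_of_le hq)
  have := congrArg (Polynomial.eval 1) (Lagrange.eq_interpolate hv.injOn hdeg)
  rw [Lagrange.interpolate_apply, Polynomial.eval_finsetSum, h] at this
  simp only [one_smul, Polynomial.eval_mul, Polynomial.eval_C, h] at this
  rw [this]
  exact Finset.sum_congr rfl fun i _ => mul_comm _ _

/-- A Lipschitz map on a closed ball that vanishes on the sphere stays Lipschitz
when it is extended by zero. -/
theorem lipschitzWith_indicator_closedBall {E F : Type*} [NormedAddCommGroup E] [NormedSpace ℝ E]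
    [NormedAddCommGroup F] {φ : E → F} {ρ : ℝ} {K : ℝ≥0}
    (hφ : LipschitzOnWith K φ (Metric.closedBall 0 ρ)) (h0 : ∀ x, ‖x‖ = ρ → φ x = 0) :
    LipschitzWith K ((Metric.closedBall (0 : E) ρ).indicator φ) := by
  classical
  have key : ∀ x y : E, ‖x‖ ≤ ρ → ρ < ‖y‖ → dist (φ x) 0 ≤ K * dist x y := by
    intro x y hx hy
    have hc : ContinuousOn (fun t : ℝ => ‖AffineMap.lineMap x y t‖) (Set.Icc 0 1) := by
      have : Continuous (fun t : ℝ => (AffineMap.lineMap x y t : E)) := AffineMap.lineMap_continuous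
      exact this.norm.continuousOn
    -- The segment from `x` to `y` crosses the sphere, where `φ` vanishes, and the crossing point is
    -- no farther from `x` than `y` is.
    obtain ⟨t, ht, hz⟩ := intermediate_value_Icc zero_le_one hc
      (show ρ ∈ _ by simpa using ⟨hx, hy.le⟩)
    simp only at hz
    rw [← h0 _ hz]
    refine (hφ.dist_le_mul x (by simpa using hx) _ (by simpa using hz.le)).trans ?_
    gcongr
    rw [dist_left_lineMap, Real.norm_of_nonneg ht.1]
    exact mul_le_of_le_one_left dist_nonneg ht.2
  refine LipschitzWith.of_dist_le_mul fun x y => ?_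
  by_cases hx : ‖x‖ ≤ ρ <;> by_cases hy : ‖y‖ ≤ ρ
  · rw [Set.indicator_of_mem (by simpa using hx), Set.indicator_of_mem (by simpa using hy)]
    exact hφ.dist_le_mul x (by simpa using hx) y (by simpa using hy)
  · rw [Set.indicator_of_mem (by simpa using hx), Set.indicator_of_notMem (by simpa using hy)]
    exact key x y hx (not_le.1 hy)
  · rw [Set.indicator_of_notMem (by simpa using hx), Set.indicator_of_mem (by simpa using hy),
      dist_comm, dist_comm x]
    exact key y x hy (not_le.1 hx)
  · rw [Set.indicator_of_notMem (by simpa using hx), Set.indicator_of_notMem (by simpa using hy),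
      dist_self]
    positivity

/-- A small Lipschitz perturbation of the identity supported in a ball maps the ball bijectively
onto itself. -/
theorem injective_and_image_ball_of_lipschitz_perturbation {E : Type*} [NormedAddCommGroup E]
    [NormedSpace ℝ E] [CompleteSpace E] {ψ : E → E} {ρ : ℝ} {c : ℝ≥0} (hc : c < 1)
    (hψ : LipschitzWith c ψ) (h0 : ∀ x, ρ ≤ ‖x‖ → ψ x = 0) :
    Function.Injective (fun x => x + ψ x) ∧
      (fun x => x + ψ x) '' Metric.ball 0 ρ = Metric.ball 0 ρ := by
  have happ : ApproximatesLinearOn (fun x => x + ψ x)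
      ((ContinuousLinearEquiv.refl ℝ E : E ≃L[ℝ] E) : E →L[ℝ] E) Set.univ c := by
    intro x _ y _
    have : x + ψ x - (y + ψ y) - ((ContinuousLinearEquiv.refl ℝ E : E ≃L[ℝ] E) : E →L[ℝ] E) (x - y)
        = ψ x - ψ y := by
      simp only [ContinuousLinearEquiv.coe_refl, ContinuousLinearMap.id_apply]
      abel
    rw [this]
    exact hψ.norm_sub_le x y
  have hc' : Subsingleton E ∨ c < ‖((ContinuousLinearEquiv.refl ℝ E : E ≃L[ℝ] E).symm :
      E →L[ℝ] E)‖₊⁻¹ := by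
    rcases subsingleton_or_nontrivial E with h | h
    · exact Or.inl h
    · right
      simpa using hc
  have hinj : Function.Injective (fun x => x + ψ x) :=
    Set.injOn_univ.1 (happ.injOn hc')
  have hsurj := happ.surjective hc'
  refine ⟨hinj, Set.Subset.antisymm ?_ ?_⟩
  · rintro _ ⟨x, hx, rfl⟩
    by_contra hn
    have hn' : ρ ≤ ‖x + ψ x‖ := by simpa using hn
    -- A point sent out of the ball would land on a fixed point of the map, hence by injectivity be
    -- that fixed point, which lies outside the ball.
    have := hinj (show (x + ψ x) + ψ (x + ψ x) = x + ψ x by rw [h0 _ hn', add_zero])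
    rw [this] at hn'
    exact absurd (by simpa using hx) (not_lt.2 hn')
  · intro y hy
    obtain ⟨x, rfl⟩ := hsurj y
    refine ⟨x, ?_, rfl⟩
    by_contra hn
    simp only [h0 x (by simpa using hn), add_zero] at hy
    exact hn hy

/-- There is no continuously differentiable retraction of a ball onto its sphere. -/
theorem no_contDiff_retraction {E : Type*} [NormedAddCommGroup E] [InnerProductSpace ℝ E]
    [FiniteDimensional ℝ E] {h : E → E} (hh : ContDiff ℝ 1 h) {ρ : ℝ} (hρ : 0 < ρ)
    (hn : ∀ x, ‖h x‖ = ρ) (hs : ∀ x, ‖x‖ = ρ → h x = x) : False := by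
  borelize E
  let μ : Measure E := Measure.addHaar
  let φ : E → E := fun x => h x - x
  have hφ : ContDiff ℝ 1 φ := hh.sub contDiff_id
  let D : E → E →L[ℝ] E := fderiv ℝ φ
  have hD : Continuous D := hφ.continuous_fderiv (by norm_num)
  obtain ⟨C, hC⟩ : ∃ C : ℝ≥0, ∀ x ∈ Metric.closedBall (0 : E) ρ, ‖D x‖₊ ≤ C := by
    obtain ⟨C, hC⟩ := (isCompact_closedBall (0 : E) ρ).exists_bound_of_continuousOn hD.continuousOn
    exact ⟨C.toNNReal, fun x hx => by
      rw [← NNReal.coe_le_coe]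
      exact (hC x hx).trans (Real.le_coe_toNNReal C)⟩
  have hlip : LipschitzOnWith C φ (Metric.closedBall 0 ρ) :=
    (convex_closedBall 0 ρ).lipschitzOnWith_of_nnnorm_fderiv_le
      (fun x _ => (hφ.differentiable (by norm_num)) x) hC
  have hlip' := lipschitzWith_indicator_closedBall hlip (fun x hx => by simp [φ, hs x hx])
  set φ' := (Metric.closedBall (0 : E) ρ).indicator φ with hφ'
  have hφ'0 : ∀ x, ρ ≤ ‖x‖ → φ' x = 0 := by
    intro x hx
    rcases hx.eq_or_lt with hx | hx
    · rw [hφ', Set.indicator_of_mem (by simpa using hx.ge)]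
      simp [φ, hs x hx.symm]
    · rw [hφ', Set.indicator_of_notMem (by simpa using hx)]
  have hdetc : Continuous fun A : E →L[ℝ] E => (ContinuousLinearMap.id ℝ E + A).det :=
    ContinuousLinearMap.continuous_det.comp (continuous_const.add continuous_id)
  obtain ⟨η, hη, hdet⟩ : ∃ η > 0, ∀ A : E →L[ℝ] E, ‖A‖ < η →
      0 < (ContinuousLinearMap.id ℝ E + A).det := by
    have : ∀ᶠ A in nhds (0 : E →L[ℝ] E), 0 < (ContinuousLinearMap.id ℝ E + A).det := by
      refine hdetc.continuousAt.eventually_const_lt ?_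
      simp [ContinuousLinearMap.det]
    obtain ⟨η, hη, H⟩ := Metric.eventually_nhds_iff.1 this
    exact ⟨η, hη, fun A hA => H (by simpa using hA)⟩
  -- For small `t` the map `x + t φ'(x)` is a bijection of the ball with positive Jacobian, so by
  -- change of variables the integral of the Jacobian is the volume of the ball.
  have hball : ∀ t : ℝ, 0 ≤ t → t * C < 1 → t * C < η →
      ∫ x in Metric.ball (0 : E) ρ, (ContinuousLinearMap.id ℝ E + t • D x).det ∂μ
        = μ.real (Metric.ball 0 ρ) := by
    intro t ht ht1 htη
    have hl : LipschitzWith (t.toNNReal * C) (fun x => t • φ' x) := by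
      refine LipschitzWith.of_dist_le_mul fun x y => ?_
      rw [dist_smul₀, NNReal.coe_mul, Real.coe_toNNReal t ht, Real.norm_of_nonneg ht, mul_assoc]
      exact mul_le_mul_of_nonneg_left (hlip'.dist_le_mul x y) ht
    obtain ⟨hinj, himg⟩ := injective_and_image_ball_of_lipschitz_perturbation (ρ := ρ)
      (by rw [← NNReal.coe_lt_coe]; simpa [ht] using ht1) hl
      (fun x hx => by simp [hφ'0 x hx])
    have hder : ∀ x ∈ Metric.ball (0 : E) ρ, HasFDerivWithinAt (fun x => x + t • φ' x)
        (ContinuousLinearMap.id ℝ E + t • D x) (Metric.ball 0 ρ) x := by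
      intro x hx
      have h1 : HasFDerivAt (fun x => x + t • φ x) (ContinuousLinearMap.id ℝ E + t • D x) x :=
        (hasFDerivAt_id x).add
          (((hφ.differentiable (by norm_num)) x).hasFDerivAt.const_smul t)
      refine h1.hasFDerivWithinAt.congr (fun y hy => ?_) ?_
      · rw [hφ', Set.indicator_of_mem (Metric.ball_subset_closedBall hy)]
      · rw [hφ', Set.indicator_of_mem (Metric.ball_subset_closedBall hx)]
    have hcv := integral_image_eq_integral_abs_det_fderiv_smul μ measurableSet_ball hder
      hinj.injOn (fun _ => (1 : ℝ))
    rw [himg] at hcv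
    simp only [smul_eq_mul, mul_one, integral_const, measureReal_restrict_apply_univ] at hcv
    rw [hcv]
    refine setIntegral_congr_fun measurableSet_ball fun x hx => (abs_of_pos (hdet _ ?_)).symm
    rw [norm_smul, Real.norm_of_nonneg ht]
    refine lt_of_le_of_lt (mul_le_mul_of_nonneg_left ?_ ht) htη
    exact hC x (Metric.ball_subset_closedBall hx)
  obtain ⟨δ, hδ, hδ1⟩ : ∃ δ : ℝ, 0 < δ ∧ δ * C < min 1 η := by
    refine ⟨min 1 η / (C + 1), by positivity, ?_⟩
    rw [div_mul_eq_mul_div, div_lt_iff₀ (by positivity)]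
    have : 0 < min 1 η := lt_min one_pos hη
    nlinarith
  -- Distinct interpolation nodes, all in the range of `t` where `hball` applies.
  let v : ℕ → ℝ := fun i => δ / (i + 1)
  have hv : Function.Injective v := by
    intro i j hij
    simp only [v] at hij
    rw [div_eq_div_iff (by positivity) (by positivity)] at hij
    have := mul_left_cancel₀ hδ.ne' hij
    exact_mod_cast (add_right_cancel this).symm
  have hv0 : ∀ i, 0 ≤ v i := fun i => by positivity
  have hvδ : ∀ i, v i * C < min 1 η := fun i => by
    refine lt_of_le_of_lt (mul_le_mul_of_nonneg_right ?_ C.2) hδ1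
    exact div_le_self hδ.le (by simp)
  -- The integral is polynomial in `t` and constant at enough nodes, so it has the same value at `t
  -- = 1`. In Lagrange form: the basis polynomials sum to 1.
  have hone : ∫ x in Metric.ball (0 : E) ρ, (ContinuousLinearMap.id ℝ E + D x).det ∂μ
        = μ.real (Metric.ball 0 ρ) := by
    rw [integral_congr_ae (Filter.Eventually.of_forall fun x =>
      ContinuousLinearMap.det_id_add_eq_sum_basis hv (D x))]
    rw [integral_finsetSum]
    · simp_rw [integral_const_mul, hball _ (hv0 _) ((hvδ _).trans_le (min_le_left _ _))
        ((hvδ _).trans_le (min_le_right _ _))]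
      rw [← Finset.sum_mul, ← Polynomial.eval_finsetSum, Lagrange.sum_basis hv.injOn (by simp)]
      simp
    · intro i _
      refine Integrable.const_mul ?_ _
      have : ContinuousOn (fun x => (ContinuousLinearMap.id ℝ E + v i • D x).det)
          (Metric.closedBall 0 ρ) :=
        (hdetc.comp (hD.const_smul (v i))).continuousOn
      exact (this.integrableOn_compact (isCompact_closedBall _ _)).mono_set
        Metric.ball_subset_closedBall
  -- As `‖h‖` is constant, the range of the derivative is orthogonal to `h x`. An invertible
  -- derivative would have `h x` itself in its range, forcing `ρ = 0`.
  have hzero : ∀ x, (ContinuousLinearMap.id ℝ E + D x).det = 0 := by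
    intro x
    by_contra hne
    have hx : HasFDerivAt h (ContinuousLinearMap.id ℝ E + D x) x := by
      have := (hasFDerivAt_id x).add ((hφ.differentiable (by norm_num)) x).hasFDerivAt
      refine this.congr_of_eventuallyEq (Filter.Eventually.of_forall fun y => ?_)
      simp [φ]
    have hsq : HasFDerivAt (fun y => ‖h y‖ ^ 2) _ x := hx.norm_sq
    have hconst : (fun y => ‖h y‖ ^ 2) = fun _ => ρ ^ 2 := by ext y; rw [hn]
    rw [hconst] at hsq
    have h0 := hsq.unique (hasFDerivAt_const _ _)
    obtain ⟨y, hy⟩ : ∃ y, (ContinuousLinearMap.id ℝ E + D x) y = h x := by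
      exact (LinearMap.equivOfDetNeZero
        ((ContinuousLinearMap.id ℝ E + D x : E →L[ℝ] E) : E →ₗ[ℝ] E) hne).surjective (h x)
    have h1 := congrArg (fun L : E →L[ℝ] ℝ => L y) h0
    have h2 : inner ℝ (h x) y + inner ℝ (h x) (D x y) = ρ ^ 2 := by
      rw [← hn x, ← real_inner_self_eq_norm_sq, ← inner_add_right]
      exact congrArg (inner ℝ (h x)) hy
    simp at h1
    nlinarith [sq_pos_of_pos hρ]
  simp only [hzero, integral_zero] at hone
  have : 0 < μ.real (Metric.ball (0 : E) ρ) :=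
    ENNReal.toReal_pos (Metric.measure_ball_pos μ 0 hρ).ne' measure_ball_lt_top.ne
  exact this.ne hone

/-- **Brouwer's fixed point theorem**, for a bounded continuous self-map of a Euclidean space. -/
theorem exists_fixedPoint_of_continuous_of_bounded {E : Type*} [NormedAddCommGroup E]
    [InnerProductSpace ℝ E] [FiniteDimensional ℝ E] {f : E → E} (hf : Continuous f) {R : ℝ}
    (hR : ∀ x, ‖f x‖ ≤ R) : ∃ x, f x = x := by
  by_contra! hfix
  wlog hR0 : 0 < R generalizing R
  · exact this (R := max R 1) (fun x => (hR x).trans (le_max_left _ _)) (by positivity)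
  -- A cutoff, 1 on the ball of radius `R` and 0 beyond `2R`, makes `x - χ(x) f(x)` the identity far
  -- away. It creates no zero, since a zero has norm at most `R`, where `χ = 1`, and would be a
  -- fixed point of `f`.
  let χ : E → ℝ := fun x => max 0 (min 1 (2 - ‖x‖ / R))
  have hχ : Continuous χ := by fun_prop
  have hχ1 : ∀ x, ‖x‖ ≤ R → χ x = 1 := fun x hx => by
    have : ‖x‖ / R ≤ 1 := (div_le_one hR0).2 hx
    simp only [χ]
    rw [min_eq_left (by linarith), max_eq_right zero_le_one]
  have hχ0 : ∀ x, 2 * R ≤ ‖x‖ → χ x = 0 := fun x hx => by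
    have : 2 ≤ ‖x‖ / R := (le_div_iff₀ hR0).2 hx
    exact max_eq_left ((min_le_right _ _).trans (by linarith))
  have hχ01 : ∀ x, |χ x| ≤ 1 := fun x => by
    rw [abs_of_nonneg (le_max_left _ _)]
    exact max_le zero_le_one (min_le_left _ _)
  let g : E → E := fun x => x - χ x • f x
  have hg : Continuous g := continuous_id.sub (hχ.smul hf)
  have hg0 : ∀ x, g x ≠ 0 := fun x hx => by
    have hx' : χ x • f x = x := (sub_eq_zero.1 hx).symm
    have hxR : ‖x‖ ≤ R := by
      rw [← hx', norm_smul]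
      exact (mul_le_of_le_one_left (norm_nonneg _) (hχ01 x)).trans (hR x)
    rw [hχ1 x hxR, one_smul] at hx'
    exact hfix x hx'
  have hgid : ∀ x, 2 * R ≤ ‖x‖ → g x = x := fun x hx => by simp [g, hχ0 x hx]
  -- The error is smaller than `‖g x‖`, so the smooth `p` is still nowhere zero. It equals `g`,
  -- hence the identity, beyond `3R`, so normalizing it retracts onto the sphere of radius `3R`.
  obtain ⟨p, hp, hpd, hpe, -⟩ := hg.exists_contDiff_approx_and_eqOn 1 (ε := fun x => ‖g x‖)
    hg.norm (fun x => norm_pos_iff.2 (hg0 x))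
    (S := {x | 3 * R ≤ ‖x‖}) (U := {x | 2 * R < ‖x‖})
    (isClosed_le continuous_const continuous_norm)
    ((isOpen_lt continuous_const continuous_norm).mem_nhdsSet.2 fun x hx =>
      show 2 * R < ‖x‖ from lt_of_lt_of_le (by linarith) hx)
    (contDiff_id.contDiffOn.congr fun x hx => hgid x (le_of_lt hx))
  have hp0 : ∀ x, p x ≠ 0 := fun x hx => by
    have := hpd x
    rw [hx, dist_zero_left] at this
    exact lt_irrefl _ this
  have hp' : ContDiff ℝ 1 fun x => ‖p x‖⁻¹ := (hp.norm ℝ hp0).inv fun x => norm_ne_zero_iff.2 (hp0 x)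
  refine no_contDiff_retraction (h := fun x => (3 * R) • ‖p x‖⁻¹ • p x)
    (contDiff_const.smul (hp'.smul hp)) (ρ := 3 * R) (by positivity) (fun x => ?_) (fun x hx => ?_)
  · rw [norm_smul, norm_smul, norm_inv, norm_norm, inv_mul_cancel₀ (norm_ne_zero_iff.2 (hp0 x)),
      mul_one, Real.norm_of_nonneg (by positivity)]
  · have : p x = x := (hpe (show 3 * R ≤ ‖x‖ from hx.ge)).trans (hgid x (by linarith))
    simp only [this]
    rw [smul_smul, hx, mul_inv_cancel₀ (by positivity), one_smul]

/-! ### Ky Fan's inequality. -/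

/-- A **Ky Fan inequality**: on a compact convex set `K`, a jointly continuous `Φ` that is convex
in its second argument admits `u ∈ K` such that `u` minimizes `Φ u` over `K`. -/
theorem exists_mem_forall_le_of_convexOn {E : Type*} [NormedAddCommGroup E]
    [InnerProductSpace ℝ E] [FiniteDimensional ℝ E] {K : Set E} (hK : IsCompact K)
    (hne : K.Nonempty) {Φ : E → E → ℝ} (hΦ : Continuous (Function.uncurry Φ))
    (hconv : ∀ u, ConvexOn ℝ K (Φ u)) : ∃ u ∈ K, ∀ v ∈ K, Φ u u ≤ Φ u v := by
  obtain ⟨k₀, hk₀⟩ := hne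
  have hKc : Convex ℝ K := (hconv k₀).1
  -- The quadratic term makes the minimizer over `K` unique, so that it defines a function of `x`.
  -- At a fixed point the term is centred at the minimizer itself and has no first-order effect.
  let Ψ : E → E → ℝ := fun x v => Φ x v + ‖v - x‖ ^ 2
  have hΨ : Continuous (Function.uncurry Ψ) :=
    hΦ.add ((continuous_snd.sub continuous_fst).norm.pow 2)
  have huniq : ∀ x, ∀ v ∈ K, ∀ w ∈ K, (∀ y ∈ K, Ψ x v ≤ Ψ x y) → (∀ y ∈ K, Ψ x w ≤ Ψ x y) →
      v = w := by
    intro x v hv w hw hvm hwm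
    have hz : (1 / 2 : ℝ) • v + (1 / 2 : ℝ) • w ∈ K :=
      hKc hv hw (by norm_num) (by norm_num) (by norm_num)
    have h1 := hvm _ hz
    have h2 := hwm _ hz
    have h3 := (hconv x).2 hv hw (show (0 : ℝ) ≤ 1 / 2 by norm_num)
      (show (0 : ℝ) ≤ 1 / 2 by norm_num) (by norm_num)
    have h4 := parallelogram_law_with_norm ℝ (v - x) (w - x)
    have h5 : (1 / 2 : ℝ) • v + (1 / 2 : ℝ) • w - x = (1 / 2 : ℝ) • (v - x + (w - x)) := by
      module
    have h6 : v - x - (w - x) = v - w := by abel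
    simp only [Ψ, h5, norm_smul, mul_pow] at h1 h2
    simp only [h6, smul_eq_mul] at h3 h4
    norm_num at h1 h2
    have h7 : ‖v - w‖ * ‖v - w‖ ≤ 0 := by nlinarith
    have h8 : ‖v - w‖ = 0 := by nlinarith [norm_nonneg (v - w)]
    exact sub_eq_zero.1 (norm_eq_zero.1 h8)
  have hex : ∀ x, ∃ v ∈ K, ∀ y ∈ K, Ψ x v ≤ Ψ x y := fun x =>
    hK.exists_isMinOn ⟨k₀, hk₀⟩ (hΨ.comp (Continuous.prodMk_right x)).continuousOn
  choose q hqK hq using hex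
  have hqc : Continuous q := by
    refine continuous_iff_continuousAt.2 fun x => ?_
    -- By compactness it suffices that every cluster point of `q` at `x` minimizes `Ψ x`, which
    -- passes to the limit from the nearby minimizers.
    refine hK.tendsto_nhds_of_unique_mapClusterPt (Filter.Eventually.of_forall hqK) ?_
    intro y hy hcl
    obtain ⟨U, hU, hUy⟩ := mapClusterPt_iff_ultrafilter.1 hcl
    refine huniq x y hy _ (hqK x) (fun v hv => ?_) (hq x)
    have t1 : Filter.Tendsto (fun z => Ψ z (q z)) U (nhds (Ψ x y)) :=
      (hΨ.tendsto (x, y)).comp ((show Filter.Tendsto id (U : Filter E) (nhds x) from hU).prodMk_nhds hUy)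
    have t2 : Filter.Tendsto (fun z => Ψ z v) U (nhds (Ψ x v)) :=
      ((hΨ.comp (Continuous.prodMk_left v)).tendsto x).mono_left hU
    exact le_of_tendsto_of_tendsto' t1 t2 fun z => hq z v hv
  obtain ⟨R, hR⟩ := hK.isBounded.exists_norm_le
  obtain ⟨u, hu⟩ := exists_fixedPoint_of_continuous_of_bounded hqc (fun x => hR _ (hqK x))
  have huK : u ∈ K := hu ▸ hqK u
  refine ⟨u, huK, fun v hv => ?_⟩
  have hmin : ∀ t : ℝ, 0 < t → t ≤ 1 → Φ u u ≤ Φ u v + t * ‖v - u‖ ^ 2 := by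
    intro t ht ht1
    have h1 := (hconv u).2 huK hv (show 0 ≤ 1 - t by linarith) ht.le (by ring)
    have h2 := hq u _ (hKc huK hv (a := 1 - t) (b := t) (by linarith) ht.le (by ring))
    rw [hu] at h2
    have h3 : (1 - t) • u + t • v - u = t • (v - u) := by module
    simp only [Ψ, h3, sub_self, norm_zero, norm_smul, mul_pow, Real.norm_eq_abs, sq_abs] at h2
    simp only [smul_eq_mul] at h1
    have : t * Φ u u ≤ t * (Φ u v + t * ‖v - u‖ ^ 2) := by nlinarith
    exact le_of_mul_le_mul_left this ht
  have hlim : Filter.Tendsto (fun t : ℝ => Φ u v + t * ‖v - u‖ ^ 2) (nhdsWithin 0 (Set.Ioi 0))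
      (nhds (Φ u v)) := by
    have : Continuous fun t : ℝ => Φ u v + t * ‖v - u‖ ^ 2 := by fun_prop
    simpa using (this.tendsto 0).mono_left nhdsWithin_le_nhds
  refine ge_of_tendsto hlim ?_
  filter_upwards [Ioc_mem_nhdsGT (zero_lt_one' ℝ)] with t ht using hmin t ht.1 ht.2

/-! ### Separation and multipliers for convex functions. -/

/-- A **theorem of the alternative** for convex functions: if they are not simultaneously negative
at a point of `K`, some nontrivial nonnegative combination is nonnegative on `K`. -/
theorem exists_nonneg_combination_nonneg {E ι : Type*} [AddCommGroup E] [Module ℝ E] [Fintype ι]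
    {K : Set E} (hne : K.Nonempty) (hKc : Convex ℝ K) {b : ι → E → ℝ}
    (hb : ∀ i, ConvexOn ℝ K (b i)) (hneg : ¬∃ v ∈ K, ∀ i, b i v < 0) :
    ∃ c : ι → ℝ, (∀ i, 0 ≤ c i) ∧ c ≠ 0 ∧ ∀ v ∈ K, 0 ≤ ∑ i, c i * b i v := by
  classical
  obtain ⟨v₀, hv₀⟩ := hne
  let S : Set (ι → ℝ) := {y | ∃ v ∈ K, ∀ i, b i v < y i}
  have hSo : IsOpen S := by
    have : S = ⋃ v ∈ K, ⋂ i, {y : ι → ℝ | b i v < y i} := by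
      ext y; simp [S]
    rw [this]
    exact isOpen_biUnion fun v _ => isOpen_iInter_of_finite fun i =>
      isOpen_lt continuous_const (continuous_apply i)
  have hSc : Convex ℝ S := by
    rintro y ⟨v, hv, hvy⟩ z ⟨w, hw, hwz⟩ α β hα hβ hαβ
    refine ⟨α • v + β • w, hKc hv hw hα hβ hαβ, fun i => ?_⟩
    refine ((hb i).2 hv hw hα hβ hαβ).trans_lt ?_
    simp only [Pi.add_apply, Pi.smul_apply, smul_eq_mul]
    rcases hα.eq_or_lt with h | h
    · have hβ1 : β = 1 := by linarith
      subst hβ1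
      simpa [← h] using hwz i
    · have := mul_lt_mul_of_pos_left (hvy i) h
      have := mul_le_mul_of_nonneg_left (hwz i).le hβ
      linarith
  have h0S : (0 : ι → ℝ) ∉ S := fun ⟨v, hv, h⟩ => hneg ⟨v, hv, h⟩
  obtain ⟨f, hf⟩ := geometric_hahn_banach_open_point hSc hSo h0S
  let c : ι → ℝ := fun i => -f (Pi.single i 1)
  have hfc : ∀ y, f y = -∑ i, c i * y i := by
    intro y
    conv_lhs => rw [← Finset.univ_sum_single y]
    rw [map_sum, ← Finset.sum_neg_distrib]
    refine Finset.sum_congr rfl fun i _ => ?_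
    have : (Pi.single i (y i) : ι → ℝ) = y i • Pi.single i 1 := by
      rw [← Pi.single_smul, smul_eq_mul, mul_one]
    rw [this, map_smul]
    simp only [c, smul_eq_mul]
    ring
  have hpos : ∀ y ∈ S, 0 < ∑ i, c i * y i := by
    intro y hy
    have := hf y hy
    rw [hfc, map_zero] at this
    linarith
  refine ⟨c, fun i => ?_, fun hc => ?_, fun v hv => ?_⟩
  -- With `c i < 0`, raising coordinate `i` by `r / -c i` stays in the upward closed set `S` but
  -- brings the positive value `r` down to 0.
  · by_contra! hci
    set r := ∑ k, c k * (b k v₀ + 1) with hr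
    have hr0 : 0 < r := hpos (fun k => b k v₀ + 1) ⟨v₀, hv₀, fun k => by simp⟩
    have := hpos (fun k => b k v₀ + 1 + (Pi.single i (r / -c i) : ι → ℝ) k)
      ⟨v₀, hv₀, fun k => by
        have : 0 ≤ (Pi.single i (r / -c i) : ι → ℝ) k := by
          have h0 : 0 ≤ (Pi.single i (r / -c i) : ι → ℝ) :=
            Pi.single_nonneg.2 (div_nonneg hr0.le (by linarith))
          exact h0 k
        linarith⟩
    simp only [mul_add (c _) (b _ v₀ + 1), Finset.sum_add_distrib, ← hr] at this
    rw [Finset.sum_eq_single i (fun k _ hk => by simp [hk]) (by simp), Pi.single_eq_same] at this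
    have h2 : c i * (r / -c i) = -r := by
      rw [div_neg, mul_neg, mul_div_cancel₀ _ hci.ne]
    linarith
  · have := hpos (fun k => b k v₀ + 1) ⟨v₀, hv₀, fun k => by simp⟩
    simp [hc] at this
  · have hlim : Filter.Tendsto (fun t : ℝ => ∑ i, c i * (b i v + t)) (nhdsWithin 0 (Set.Ioi 0))
        (nhds (∑ i, c i * b i v)) := by
      have : Continuous fun t : ℝ => ∑ i, c i * (b i v + t) := by fun_prop
      simpa using (this.tendsto 0).mono_left nhdsWithin_le_nhds
    refine ge_of_tendsto hlim ?_
    filter_upwards [self_mem_nhdsWithin] with t ht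
    exact (hpos _ ⟨v, hv, fun i => by simpa using ht⟩).le

/-- Multipliers for a linearized problem whose constraint functionals `a j` have a common direction
of strict decrease. -/
theorem exists_multipliers_of_linearized {E ι : Type*} [AddCommGroup E] [Module ℝ E] [Fintype ι]
    {K : Set E} (hKc : Convex ℝ K) {f : E → ℝ} (hf : ConvexOn ℝ K f) {a : ι → E → ℝ}
    (ha : ∀ j, ConvexOn ℝ K (a j)) (hmin : ∀ v ∈ K, (∀ j, a j v < 0) → 0 ≤ f v)
    (hslater : ∃ v ∈ K, ∀ j, a j v < 0) :
    ∃ c : ι → ℝ, (∀ j, 0 ≤ c j) ∧ ∀ v ∈ K, 0 ≤ f v + ∑ j, c j * a j v := by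
  obtain ⟨w, hw, hwa⟩ := hslater
  obtain ⟨c, hc0, hcne, hc⟩ := exists_nonneg_combination_nonneg ⟨w, hw⟩ hKc
    (b := fun o : Option ι => o.elim f a) (fun o => by cases o <;> simp [hf, ha]) (by
      rintro ⟨v, hv, h⟩
      exact absurd (hmin v hv fun j => h (some j)) (not_le.2 (h none)))
  simp only [Fintype.sum_option, Option.elim] at hc
  -- Slater's point excludes a vanishing objective weight: all the constraint terms at `w` would
  -- then be zero, hence all the weights.
  have hpos : 0 < c none := by
    refine (hc0 none).lt_of_ne fun h0 => hcne ?_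
    have hs := hc w hw
    rw [← h0, zero_mul, zero_add] at hs
    have hle : ∀ j ∈ Finset.univ, c (some j) * a j w ≤ 0 := fun j _ =>
      mul_nonpos_of_nonneg_of_nonpos (hc0 _) (hwa j).le
    have hz := (Finset.sum_eq_zero_iff_of_nonpos hle).1 (le_antisymm (Finset.sum_nonpos hle) hs)
    ext o
    cases o with
    | none => exact h0.symm
    | some j => exact (mul_eq_zero.1 (hz j (Finset.mem_univ j))).resolve_right (hwa j).ne
  refine ⟨fun j => c (some j) / c none, fun j => div_nonneg (hc0 _) hpos.le, fun v hv => ?_⟩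
  have := div_nonneg (hc v hv) hpos.le
  rw [add_div, mul_div_cancel_left₀ _ hpos.ne', Finset.sum_div] at this
  simpa only [div_mul_eq_mul_div] using this

/-! ### Directional derivatives of expectations. -/

section DifferentiationUnderIntegral

open Filter Topology

/-- A random variable that is the derivative at `0` of a family of measurable ones is measurable. -/
theorem aestronglyMeasurable_of_hasDerivAt {Ξ : Type*} [MeasurableSpace Ξ] {P : Measure Ξ}
    {h : ℝ → Ξ → ℝ} {h' : Ξ → ℝ} (hm : ∀ t ∈ Set.Icc (0 : ℝ) 1, AEStronglyMeasurable (h t) P)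
    (hd : ∀ ω, HasDerivAt (fun t => h t ω) (h' ω) 0) : AEStronglyMeasurable h' P := by
  have hu : Tendsto (fun k : ℕ => 1 / ((k : ℝ) + 1)) atTop (𝓝[>] 0) :=
    tendsto_nhdsWithin_iff.2 ⟨tendsto_one_div_add_atTop_nhds_zero_nat,
      Eventually.of_forall fun k => Set.mem_Ioi.2 (by positivity)⟩
  refine aestronglyMeasurable_of_tendsto_ae atTop
    (f := fun (k : ℕ) ω => (1 / ((k : ℝ) + 1))⁻¹ * (h (1 / ((k : ℝ) + 1)) ω - h 0 ω))
    (fun k => ?_) (ae_of_all _ fun ω => ?_)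
  · refine ((hm _ ⟨by positivity, ?_⟩).sub (hm 0 (by simp))).const_mul _
    rw [div_le_one (by positivity)]
    simp
  · have := (hasDerivAt_iff_tendsto_slope_zero.1 (hd ω)).mono_left
      (nhdsWithin_mono _ fun x hx => ne_of_gt hx : 𝓝[>] (0 : ℝ) ≤ _)
    simpa [Function.comp_def] using this.comp hu

/-- One-sided differentiation under the integral sign, with a dominated difference quotient. -/
theorem tendsto_slope_integral {Ξ : Type*} [MeasurableSpace Ξ] {P : Measure Ξ}
    {h : ℝ → Ξ → ℝ} {h' b : Ξ → ℝ} (hi : ∀ t ∈ Set.Icc (0 : ℝ) 1, Integrable (h t) P)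
    (hb : Integrable b P) (hle : ∀ ω, ∀ t ∈ Set.Ioc (0 : ℝ) 1, |h t ω - h 0 ω| ≤ t * b ω)
    (hd : ∀ ω, HasDerivAt (fun t => h t ω) (h' ω) 0) :
    Integrable h' P ∧
      Tendsto (fun t => t⁻¹ * (∫ ω, h t ω ∂P - ∫ ω, h 0 ω ∂P)) (𝓝[>] 0) (𝓝 (∫ ω, h' ω ∂P)) := by
  have hlim : ∀ ω, Tendsto (fun t => t⁻¹ * (h t ω - h 0 ω)) (𝓝[>] 0) (𝓝 (h' ω)) := fun ω => by
    have := (hasDerivAt_iff_tendsto_slope_zero.1 (hd ω)).mono_left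
      (nhdsWithin_mono _ fun x hx => ne_of_gt hx : 𝓝[>] (0 : ℝ) ≤ _)
    simpa using this
  have hbd : ∀ ω, ∀ t ∈ Set.Ioc (0 : ℝ) 1, ‖t⁻¹ * (h t ω - h 0 ω)‖ ≤ b ω := fun ω t ht => by
    rw [norm_mul, norm_inv, Real.norm_of_nonneg ht.1.le, inv_mul_le_iff₀ ht.1]
    exact hle ω t ht
  have hmem : ∀ᶠ t in 𝓝[>] (0 : ℝ), t ∈ Set.Ioc (0 : ℝ) 1 := Ioc_mem_nhdsGT zero_lt_one
  have hm := aestronglyMeasurable_of_hasDerivAt (fun t ht => (hi t ht).1) hd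
  refine ⟨hb.mono' hm (ae_of_all _ fun ω => ?_), ?_⟩
  · refine le_of_tendsto (hlim ω).norm ?_
    filter_upwards [hmem] with t ht using hbd ω t ht
  · have key := tendsto_integral_filter_of_dominated_convergence (μ := P)
      (F := fun t ω => t⁻¹ * (h t ω - h 0 ω)) (f := h') (l := 𝓝[>] (0 : ℝ)) b
      (by
        filter_upwards [hmem] with t ht
        exact (((hi t (Set.Ioc_subset_Icc_self ht)).sub (hi 0 (by simp))).const_mul _).1)
      (by filter_upwards [hmem] with t ht using ae_of_all _ fun ω => hbd ω t ht) hb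
      (ae_of_all _ hlim)
    refine key.congr' ?_
    filter_upwards [hmem] with t ht
    rw [integral_const_mul, integral_sub (hi t (Set.Ioc_subset_Icc_self ht)) (hi 0 (by simp))]

/-- A random vector of a Euclidean space is integrable if its components are. -/
theorem integrable_of_forall_integrable_inner {Ξ E : Type*} [MeasurableSpace Ξ] {P : Measure Ξ}
    [NormedAddCommGroup E] [InnerProductSpace ℝ E] [FiniteDimensional ℝ E] {X : Ξ → E}
    (h : ∀ e, Integrable (fun ω => inner ℝ (X ω) e) P) : Integrable X P := by
  let b := stdOrthonormalBasis ℝ E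
  have : X = fun ω => ∑ i, inner ℝ (X ω) (b i) • b i := by
    ext ω
    conv_lhs => rw [← b.sum_repr' (X ω)]
    exact Finset.sum_congr rfl fun i _ => by rw [real_inner_comm]
  rw [this]
  exact integrable_finsetSum _ fun i _ => (h (b i)).smul_const (b i)

/-- The expectation of a random convex function is convex. -/
theorem convexOn_integral {Ξ E : Type*} [MeasurableSpace Ξ] {P : Measure Ξ} [AddCommGroup E]
    [Module ℝ E] {f : E → Ξ → ℝ} (hi : ∀ x, Integrable (f x) P)
    (hc : ∀ ω, ConvexOn ℝ Set.univ fun x => f x ω) :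
    ConvexOn ℝ Set.univ fun x => ∫ ω, f x ω ∂P := by
  refine ⟨convex_univ, fun x _ y _ a b ha hb hab => ?_⟩
  simp only [smul_eq_mul]
  rw [← integral_const_mul, ← integral_const_mul,
    ← integral_add ((hi x).const_mul a) ((hi y).const_mul b)]
  exact integral_mono (hi _) (((hi x).const_mul a).add ((hi y).const_mul b))
    fun ω => (hc ω).2 (Set.mem_univ x) (Set.mem_univ y) ha hb hab

theorem hasDerivAt_comp_add_smul {E : Type*} [NormedAddCommGroup E] [NormedSpace ℝ E] {f : E → ℝ}
    {x : E} {f' : E →L[ℝ] ℝ} (hf : HasFDerivAt f f' x) (d : E) :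
    HasDerivAt (fun t : ℝ => f (x + t • d)) (f' d) 0 := by
  have h1 : HasDerivAt (fun t : ℝ => x + t • d) d 0 := by
    simpa using ((hasDerivAt_id (0 : ℝ)).smul_const d).const_add x
  have h2 : HasFDerivAt f f' (x + (0 : ℝ) • d) := by simpa using hf
  exact h2.comp_hasDerivAt 0 h1

/-- A convex function on a line has difference quotients bounded by its increments at `±d`. -/
theorem ConvexOn.abs_sub_le_mul {E : Type*} [AddCommGroup E] [Module ℝ E] {f : E → ℝ}
    (hf : ConvexOn ℝ Set.univ f) (x d : E) {t : ℝ} (ht : t ∈ Set.Ioc (0 : ℝ) 1) :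
    |f (x + t • d) - f x| ≤ t * (|f (x + d) - f x| + |f (x - d) - f x|) := by
  obtain ⟨h0, h1⟩ := ht
  have a1 := hf.2 (Set.mem_univ x) (Set.mem_univ (x + d)) (sub_nonneg.2 h1) h0.le (by ring)
  -- For the lower bound, `x` is written as a convex combination of `x + t d` and `x - d`.
  have a2 := hf.2 (Set.mem_univ (x + t • d)) (Set.mem_univ (x - d))
    (show 0 ≤ 1 / (1 + t) by positivity) (show 0 ≤ t / (1 + t) by positivity)
    (by field_simp)
  rw [show (1 - t) • x + t • (x + d) = x + t • d by module] at a1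
  rw [show (1 / (1 + t)) • (x + t • d) + (t / (1 + t)) • (x - d) = x by
    have : (1 / (1 + t)) * t = t / (1 + t) := by ring
    rw [smul_add, smul_smul, this, smul_sub, add_add_sub_cancel, ← add_smul]
    rw [show 1 / (1 + t) + t / (1 + t) = 1 by field_simp, one_smul]] at a2
  simp only [smul_eq_mul] at a1 a2
  have a3 : (1 + t) * f x ≤ f (x + t • d) + t * f (x - d) := by
    have := mul_le_mul_of_nonneg_left a2 (show 0 ≤ 1 + t by positivity)
    refine this.trans_eq ?_
    field_simp
  have b1 := mul_le_mul_of_nonneg_left (le_abs_self (f (x + d) - f x)) h0.le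
  have b2 := mul_le_mul_of_nonneg_left (le_abs_self (f (x - d) - f x)) h0.le
  have b3 := mul_nonneg h0.le (abs_nonneg (f (x + d) - f x))
  have b4 := mul_nonneg h0.le (abs_nonneg (f (x - d) - f x))
  rw [abs_le]
  constructor <;> nlinarith

/-- The expectation of a random convex function may be differentiated under the integral sign. -/
theorem tendsto_slope_integral_of_convexOn {Ξ E : Type*} [MeasurableSpace Ξ] {P : Measure Ξ}
    [NormedAddCommGroup E] [InnerProductSpace ℝ E] [FiniteDimensional ℝ E] {f : E → Ξ → ℝ}
    (hi : ∀ x, Integrable (f x) P) (hc : ∀ ω, ConvexOn ℝ Set.univ fun x => f x ω)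
    (hd : ∀ ω, Differentiable ℝ fun x => f x ω) (x : E) (d : E) :
    Tendsto (fun t : ℝ => t⁻¹ * (∫ ω, f (x + t • d) ω ∂P - ∫ ω, f x ω ∂P)) (𝓝[>] 0)
      (𝓝 (inner ℝ (∫ ω, gradient (fun y => f y ω) x ∂P) d)) := by
  -- All directions `e` are needed, not only `d`: integrability of the gradient vector is obtained
  -- componentwise.
  have key : ∀ e : E, _ := fun e => tendsto_slope_integral (P := P)
    (h := fun t ω => f (x + t • e) ω)
    (h' := fun ω => inner ℝ (gradient (fun y => f y ω) x) e)
    (b := fun ω => |f (x + e) ω - f x ω| + |f (x - e) ω - f x ω|)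
    (fun t _ => hi _) (((hi _).sub (hi _)).abs.add ((hi _).sub (hi _)).abs)
    (fun ω t ht => by simpa using (hc ω).abs_sub_le_mul x e ht)
    (fun ω => by
      simpa using hasDerivAt_comp_add_smul ((hd ω) x).hasGradientAt.hasFDerivAt e)
  have hint : Integrable (fun ω => gradient (fun y => f y ω) x) P :=
    integrable_of_forall_integrable_inner fun e => (key e).1
  have h2 := (key d).2
  rw [real_inner_comm, ← integral_inner hint]
  simpa [real_inner_comm] using h2

end DifferentiationUnderIntegral

/-! ### Unilateral deviations and block coordinates. -/

namespace Profile

variable {N T : ℕ} {n : Fin N → ℕ}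

/-- The inclusion of the strategies of player `i` into the profiles. -/
def incl (T : ℕ) (n : Fin N → ℕ) (i : Fin N) : Traj T (n i) →L[ℝ] Profile T n where
  toFun x := WithLp.toLp 2 (Pi.single i x)
  map_add' x y := by rw [Pi.single_add, WithLp.toLp_add]
  map_smul' c x := by rw [Pi.single_smul, WithLp.toLp_smul]; rfl
  cont := (PiLp.continuous_toLp 2 _).comp
    (show Continuous fun x => Function.update (0 : ∀ k, Traj T (n k)) i x from
      continuous_const.update i continuous_id)

theorem incl_apply (i : Fin N) (x : Traj T (n i)) :
    incl T n i x = WithLp.toLp 2 (Pi.single i x) := rfl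

theorem deviate_eq_add_incl (u : Profile T n) (i : Fin N) (x : Traj T (n i)) :
    u.deviate i x = u + incl T n i (x - u i) := by
  ext1 k
  by_cases h : k = i
  · subst h
    simp [deviate, incl_apply]
  · simp [deviate, incl_apply, h]

theorem sum_incl (d : Profile T n) : ∑ i, incl T n i (d i) = d := by
  ext1 k
  rw [WithLp.ofLp_sum, Finset.sum_apply, Finset.sum_eq_single k]
  · simp [incl_apply]
  · intro b _ hb
    simp [incl_apply, hb.symm]
  · simp

@[simp] theorem deviate_same (u : Profile T n) (i : Fin N) (x : Traj T (n i)) :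
    u.deviate i x i = x := by
  simp [deviate]

theorem deviate_of_ne (u : Profile T n) {i k : Fin N} (h : k ≠ i) (x : Traj T (n i)) :
    u.deviate i x k = u k := by
  simp [deviate, h]

@[simp] theorem deviate_self (u : Profile T n) (i : Fin N) : u.deviate i (u i) = u := by
  simp [deviate_eq_add_incl]

theorem deviate_convexCombination (u : Profile T n) (i : Fin N) (x y : Traj T (n i)) {a b : ℝ}
    (hab : a + b = 1) : u.deviate i (a • x + b • y) = a • u.deviate i x + b • u.deviate i y := by
  obtain rfl : b = 1 - a := by linarith
  simp only [deviate_eq_add_incl, map_sub, map_add, map_smul]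
  module

theorem continuous_deviate (i : Fin N) :
    Continuous fun p : Profile T n × Profile T n => p.1.deviate i (p.2 i) := by
  simp only [deviate_eq_add_incl]
  fun_prop

theorem hasFDerivAt_deviate (u : Profile T n) (i : Fin N) (x : Traj T (n i)) :
    HasFDerivAt (u.deviate i) (incl T n i) x := by
  have : u.deviate i = fun x => (u - incl T n i (u i)) + incl T n i x := by
    ext1 x
    rw [deviate_eq_add_incl, map_sub]
    abel
  rw [this]
  exact (incl T n i).hasFDerivAt.const_add _

theorem inner_eq_sum (u v : Profile T n) : inner ℝ u v = ∑ i, inner ℝ (u i) (v i) :=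
  PiLp.inner_apply u v

end Profile

/-! ### The dynamics and the strategy sets. -/

namespace DynGame

variable {N T ns m : ℕ} {n : Fin N → ℕ} {Ξ : Type*} [MeasurableSpace Ξ]
variable (G : DynGame N T ns m n Ξ)

instance isProbabilityMeasure_law : IsProbabilityMeasure G.ℙ := G.isProbability

theorem state_zero (s₀ : Vec ns) (u : Profile T n) (ω : Ξ) : G.state s₀ u ω 0 = s₀ := rfl

theorem state_succ (s₀ : Vec ns) (u : Profile T n) (ω : Ξ) (t : Fin T) :
    G.state s₀ u ω t.succ = Matrix.toEuclideanLin (G.A t) (G.state s₀ u ω t.castSucc)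
      + ∑ j, Matrix.toEuclideanLin (G.B j t) (u j t) + G.w ω t := by
  simp only [state, Fin.induction_succ]

/-- The state depends affinely on the strategies, with a deterministic linear part. -/
theorem exists_state_eq_add :
    ∃ L : Profile T n →L[ℝ] Traj (T + 1) ns,
      ∀ s₀ u ω, G.state s₀ u ω = L u + G.state s₀ 0 ω := by
  have key : ∀ t : Fin (T + 1), ∃ L : Profile T n →L[ℝ] Vec ns,
      ∀ s₀ u ω, G.state s₀ u ω t = L u + G.state s₀ 0 ω t := by
    intro t
    induction t using Fin.induction with
    | zero => exact ⟨0, fun s₀ u ω => by simp [state_zero]⟩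
    | succ t ih =>
      obtain ⟨L, hL⟩ := ih
      refine ⟨LinearMap.toContinuousLinearMap (Matrix.toEuclideanLin (G.A t)) ∘L L +
        ∑ j, LinearMap.toContinuousLinearMap (Matrix.toEuclideanLin (G.B j t)) ∘L
        (PiLp.proj 2 (fun _ : Fin T => Vec (n j)) t) ∘L
          (PiLp.proj 2 (fun i : Fin N => Traj T (n i)) j), fun s₀ u ω => ?_⟩
      rw [state_succ, state_succ, hL s₀ u ω]
      simp only [map_add, add_apply, sum_apply,
        ContinuousLinearMap.comp_apply, LinearMap.coe_toContinuousLinearMap', PiLp.proj_apply,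
        PiLp.zero_apply, map_zero, Finset.sum_const_zero, add_zero]
      abel
  choose L hL using key
  refine ⟨{ toFun := fun u => WithLp.toLp 2 fun t => L t u
            map_add' := fun u v => by ext1 t; exact map_add (L t) u v
            map_smul' := fun c u => by ext1 t; exact map_smul (L t) c u
            cont := (PiLp.continuous_toLp 2 _).comp (continuous_pi fun t => (L t).continuous) },
      fun s₀ u ω => ?_⟩
  ext1 t
  exact hL t s₀ u ω

theorem measurable_state (s₀ : Vec ns) (u : Profile T n) : Measurable (G.state s₀ u) := by
  have key : ∀ t : Fin (T + 1), Measurable fun ω => G.state s₀ u ω t := by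
    intro t
    induction t using Fin.induction with
    | zero => exact measurable_const
    | succ t ih =>
      simp only [state_succ]
      have h1 : Measurable fun ω => G.w ω t := by
        exact (PiLp.continuous_apply 2 (fun _ : Fin T => Vec ns) t).measurable.comp G.measurable_w
      have h2 : Measurable fun ω =>
          Matrix.toEuclideanLin (G.A t) (G.state s₀ u ω t.castSucc) :=
        (LinearMap.continuous_of_finiteDimensional _).measurable.comp ih
      exact (h2.add_const _).add h1
  exact (WithLp.measurable_toLp 2 _).comp (measurable_pi_lambda _ key)

variable {s₀ : Vec ns}

theorem state_convexCombination (u v : Profile T n) (ω : Ξ) {a b : ℝ} (hab : a + b = 1) :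
    G.state s₀ (a • u + b • v) ω = a • G.state s₀ u ω + b • G.state s₀ v ω := by
  obtain ⟨L, hL⟩ := G.exists_state_eq_add
  obtain rfl : b = 1 - a := by linarith
  rw [hL s₀ (a • u + _), hL s₀ u, hL s₀ v, map_add, map_smul, map_smul]
  module

theorem differentiable_state (ω : Ξ) : Differentiable ℝ fun u => G.state s₀ u ω := by
  obtain ⟨L, hL⟩ := G.exists_state_eq_add
  rw [show (fun u => G.state s₀ u ω) = fun u => L u + G.state s₀ 0 ω from
    funext fun u => hL s₀ u ω]
  exact L.differentiable.add_const _

theorem isCompact_profiles : IsCompact G.profiles := by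
  have h1 : ∀ i, IsCompact (G.strategies i) := fun i => by
    have := (isCompact_univ_pi (G.actions_compact i)).image
      (PiLp.continuous_toLp 2 (fun _ : Fin T => Vec (n i)))
    convert this using 1
    ext x
    exact ⟨fun hx => ⟨x.ofLp, fun t _ => hx t, rfl⟩, by rintro ⟨y, hy, rfl⟩ t; exact hy t trivial⟩
  have := (isCompact_univ_pi h1).image (PiLp.continuous_toLp 2 (fun i : Fin N => Traj T (n i)))
  convert this using 1
  ext x
  exact ⟨fun hx => ⟨x.ofLp, fun t _ => hx t, rfl⟩, by rintro ⟨y, hy, rfl⟩ t; exact hy t trivial⟩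

theorem convex_profiles : Convex ℝ G.profiles := fun _ hu _ hv _ _ ha hb hab i t =>
  G.actions_convex i t (hu i t) (hv i t) ha hb hab

theorem deviate_mem_profiles {u : Profile T n} (hu : u ∈ G.profiles) {i : Fin N}
    {x : Traj T (n i)} (hx : x ∈ G.strategies i) : u.deviate i x ∈ G.profiles := by
  intro k
  by_cases h : k = i
  · subst h
    simpa using hx
  · rw [Profile.deviate_of_ne _ h]
    exact hu k

end DynGame

/-! ### First-order conditions along segments. -/

section FirstOrder

open Filter Topology

/-- The one-sided directional derivative of a convex function is below its increment. -/
theorem ConvexOn.le_sub_of_tendsto_slope {E : Type*} [AddCommGroup E] [Module ℝ E] {K : Set E}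
    {f : E → ℝ} (hf : ConvexOn ℝ K f) {x y : E} (hx : x ∈ K) (hy : y ∈ K) {l : ℝ}
    (hl : Tendsto (fun t : ℝ => t⁻¹ * (f (x + t • (y - x)) - f x)) (𝓝[>] 0) (𝓝 l)) :
    l ≤ f y - f x := by
  refine le_of_tendsto hl ?_
  filter_upwards [Ioc_mem_nhdsGT (zero_lt_one' ℝ)] with t ht
  have h := hf.2 hx hy (sub_nonneg.2 ht.2) ht.1.le (by ring)
  rw [show (1 - t) • x + t • y = x + t • (y - x) by module] at h
  rw [inv_mul_le_iff₀ ht.1]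
  simp only [smul_eq_mul] at h
  linarith

theorem Convex.eventually_add_smul_sub_mem {E : Type*} [AddCommGroup E] [Module ℝ E] {K : Set E}
    (hK : Convex ℝ K) {x y : E} (hx : x ∈ K) (hy : y ∈ K) :
    ∀ᶠ t in 𝓝[>] (0 : ℝ), x + t • (y - x) ∈ K := by
  filter_upwards [Ioc_mem_nhdsGT (zero_lt_one' ℝ)] with t ht
  exact hK.add_smul_sub_mem hx hy ⟨ht.1.le, ht.2⟩

theorem Differentiable.continuous_real {E : Type*} [NormedAddCommGroup E] [NormedSpace ℝ E]
    {f : E → ℝ} (hf : Differentiable ℝ f) : Continuous f :=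
  hf.continuous

theorem inner_gradient_comp {E F : Type*} [NormedAddCommGroup E] [InnerProductSpace ℝ E]
    [CompleteSpace E] [NormedAddCommGroup F] [NormedSpace ℝ F] {f : F → ℝ} {φ : E → F}
    {φ' : E →L[ℝ] F} {x : E} (hf : DifferentiableAt ℝ f (φ x)) (hφ : HasFDerivAt φ φ' x) (e : E) :
    inner ℝ (gradient (fun y => f (φ y)) x) e = fderiv ℝ f (φ x) (φ' e) := by
  have hc : HasFDerivAt (fun y => f (φ y)) ((fderiv ℝ f (φ x)).comp φ') x :=
    hf.hasFDerivAt.comp x hφ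
  rw [← hc.differentiableAt.hasGradientAt.fderiv_apply, hc.fderiv]
  rfl

namespace DynGame

variable {N T ns m : ℕ} {n : Fin N → ℕ} {Ξ : Type*} [MeasurableSpace Ξ]
variable {G : DynGame N T ns m n Ξ} {s₀ : Vec ns}

/-! ### The costs and the variational inequality. -/

namespace CostAssumption

variable (h1 : G.CostAssumption s₀)
include h1

theorem convexOn_J (i : Fin N) (u : Profile T n) (ω : Ξ) :
    ConvexOn ℝ Set.univ fun x : Traj T (n i) => G.J i s₀ (u.deviate i x) ω := by
  refine ConvexOn.add ⟨convex_univ, fun x _ y _ a b ha hb hab => ?_⟩ (h1.tilde_convex i u)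
  simp only
  rw [Profile.deviate_convexCombination u i x y hab, G.state_convexCombination _ _ ω hab]
  exact (h1.hat_convex i).2 trivial trivial ha hb hab

theorem differentiable_J (i : Fin N) (u : Profile T n) (ω : Ξ) :
    Differentiable ℝ fun x : Traj T (n i) => G.J i s₀ (u.deviate i x) ω :=
  ((h1.hat_differentiable i).comp ((G.differentiable_state ω).comp fun x =>
    (u.hasFDerivAt_deviate i x).differentiableAt)).add (h1.tilde_differentiable i u)

theorem convexOn_expCost (i : Fin N) (u : Profile T n) :
    ConvexOn ℝ Set.univ fun x : Traj T (n i) => G.expCost i s₀ (u.deviate i x) :=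
  convexOn_integral (f := fun x ω => G.J i s₀ (u.deviate i x) ω)
    (fun _ => h1.wellDefined i _) (h1.convexOn_J i u)

/-- The state is affine in the profile, so the expected state part is a finite convex function on a
finite-dimensional space, hence continuous. This is what makes Φ jointly continuous. -/
theorem continuous_expCost (i : Fin N) : Continuous (G.expCost i s₀) := by
  have hint : ∀ u, Integrable (fun ω => G.JHat i (G.state s₀ u ω)) G.ℙ := fun u => by
    have := (h1.wellDefined i u).sub (integrable_const (G.JTilde i u))
    refine this.congr (ae_of_all _ fun ω => ?_)
    simp [J]
  have hconv : ConvexOn ℝ Set.univ fun u => ∫ ω, G.JHat i (G.state s₀ u ω) ∂G.ℙ := by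
    refine convexOn_integral hint fun ω => ⟨convex_univ, fun u _ v _ a b ha hb hab => ?_⟩
    simp only
    rw [G.state_convexCombination u v ω hab]
    exact (h1.hat_convex i).2 trivial trivial ha hb hab
  have heq : G.expCost i s₀ = fun u => (∫ ω, G.JHat i (G.state s₀ u ω) ∂G.ℙ) + G.JTilde i u := by
    ext u
    simp only [expCost, J]
    rw [integral_add (hint u) (integrable_const _)]
    simp
  rw [heq]
  exact (continuousOn_univ.1 (hconv.continuousOn isOpen_univ)).add (h1.tilde_continuous i)

theorem tendsto_slope_expCost (i : Fin N) (u : Profile T n) (d : Traj T (n i)) :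
    Tendsto (fun t : ℝ => t⁻¹ * (G.expCost i s₀ (u.deviate i (u i + t • d)) - G.expCost i s₀ u))
      (𝓝[>] 0) (𝓝 (inner ℝ (G.expGradJ i s₀ u) d)) := by
  simpa [expCost, expGradJ] using tendsto_slope_integral_of_convexOn (P := G.ℙ)
    (f := fun x ω => G.J i s₀ (u.deviate i x) ω) (fun _ => h1.wellDefined i _)
    (h1.convexOn_J i u) (h1.differentiable_J i u) (u i) d

/-- A solution of the stochastic variational inequality is a variational equilibrium. -/
theorem isVariationalSGNE {u : Profile T n} (hu : G.IsSVISolution s₀ u) :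
    G.IsVariationalSGNE s₀ u := by
  refine ⟨⟨hu.1, fun i y _ hyf => ?_⟩, hu⟩
  have hvi := hu.2 _ hyf
  rw [Profile.inner_eq_sum, Finset.sum_eq_single i] at hvi
  · have hle := (h1.convexOn_expCost i u).le_sub_of_tendsto_slope (Set.mem_univ (u i))
      (Set.mem_univ y) (by simpa using h1.tendsto_slope_expCost i u (y - u i))
    have hvi' : 0 ≤ inner ℝ (G.expGradJ i s₀ u) (y - u i) := by simpa [pseudoGradient] using hvi
    simp only [Profile.deviate_self] at hle
    linarith
  · intro k _ hk
    simp [Profile.deviate_of_ne u hk]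
  · simp

/-- The stochastic variational inequality is solvable on a compact convex feasible set. -/
theorem exists_isSVISolution (hK : IsCompact (G.feasible s₀)) (hKc : Convex ℝ (G.feasible s₀))
    (hne : (G.feasible s₀).Nonempty) : ∃ u, G.IsSVISolution s₀ u := by
  -- A Nikaido–Isoda function: all players are deviated separately from `u`, but with a common
  -- feasible `v`.
  obtain ⟨u, hu, hmin⟩ := exists_mem_forall_le_of_convexOn hK hne
    (Φ := fun u v => ∑ i, G.expCost i s₀ (u.deviate i (v i)))
    (continuous_finsetSum _ fun i _ =>
      (h1.continuous_expCost i).comp (Profile.continuous_deviate i))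
    (fun u => ⟨hKc, fun x _ y _ a b ha hb hab => by
      simp only [smul_eq_mul]
      rw [Finset.mul_sum, Finset.mul_sum, ← Finset.sum_add_distrib]
      exact Finset.sum_le_sum fun i _ =>
        (h1.convexOn_expCost i u).2 (Set.mem_univ (x i)) (Set.mem_univ (y i)) ha hb hab⟩)
  refine ⟨u, hu, fun v hv => ?_⟩
  have hlim := tendsto_finsetSum Finset.univ fun i _ => h1.tendsto_slope_expCost i u (v i - u i)
  rw [Profile.inner_eq_sum]
  refine ge_of_tendsto hlim ?_
  filter_upwards [hKc.eventually_add_smul_sub_mem hu hv, self_mem_nhdsWithin] with t ht ht0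
  have := hmin _ ht
  rw [← Finset.mul_sum, Finset.sum_sub_distrib]
  refine mul_nonneg (inv_nonneg.2 (le_of_lt ht0)) (sub_nonneg.2 ?_)
  simpa using this

end CostAssumption

/-! ### The expected constraints. -/

/-- `E[∇_{uⁱ} gʲ(s₀, u, w)]`. -/
def expGradG (G : DynGame N T ns m n Ξ) (i : Fin N) (s₀ : Vec ns) (u : Profile T n) (j : Fin m) :
    Traj T (n i) :=
  ∫ ω, gradient (fun x : Traj T (n i) => G.g s₀ (u.deviate i x) ω j) (u i) ∂G.ℙ

theorem ConcentrationAssumption.integrable_g (h3 : G.ConcentrationAssumption s₀)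
    {u : Profile T n} (hu : u ∈ G.profiles) (j : Fin m) :
    Integrable (fun ω => G.g s₀ u ω j) G.ℙ :=
  ((h3.integrable _ (h3.xiBar_mem j u hu)).add (integrable_const _)).add (integrable_const _)

theorem ConcentrationAssumption.expG_apply (h3 : G.ConcentrationAssumption s₀)
    {u : Profile T n} (hu : u ∈ G.profiles) (j : Fin m) :
    G.expG s₀ u j = ∫ ω, G.g s₀ u ω j ∂G.ℙ :=
  eval_integral_piLp (fun j => h3.integrable_g hu j) j

theorem continuousOn_expG (h3 : G.ConcentrationAssumption s₀) (h4 : G.RegularityAssumption s₀)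
    (j : Fin m) : ContinuousOn (fun u => G.expG s₀ u j) G.profiles := by
  obtain ⟨ℓ, hℓ, hlip⟩ := h4.g_lipschitz
  refine (LipschitzOnWith.of_dist_le_mul (K := (∫ ω, ℓ ω ∂G.ℙ).toNNReal)
    fun u hu v hv => ?_).continuousOn
  rw [h3.expG_apply hu, h3.expG_apply hv, Real.dist_eq, dist_eq_norm,
    ← integral_sub (h3.integrable_g hu j) (h3.integrable_g hv j)]
  have hb : ∀ ω, ‖G.g s₀ u ω j - G.g s₀ v ω j‖ ≤ ℓ ω * ‖u - v‖ := fun ω =>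
    (PiLp.norm_apply_le (G.g s₀ u ω - G.g s₀ v ω) j).trans (hlip ω u hu v hv)
  refine (norm_integral_le_of_norm_le (hℓ.mul_const _) (ae_of_all _ hb)).trans ?_
  rw [integral_mul_const]
  exact mul_le_mul_of_nonneg_right (Real.le_coe_toNNReal _) (norm_nonneg _)

theorem isCompact_feasible (h3 : G.ConcentrationAssumption s₀) (h4 : G.RegularityAssumption s₀) :
    IsCompact (G.feasible s₀) := by
  have hcl : IsClosed (G.profiles ∩ ⋂ j, G.profiles ∩ (fun u => G.expG s₀ u j) ⁻¹' Set.Iic 0) :=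
    G.isCompact_profiles.isClosed.inter (isClosed_iInter fun j =>
      (continuousOn_expG h3 h4 j).preimage_isClosed_of_isClosed G.isCompact_profiles.isClosed
        isClosed_Iic)
  convert G.isCompact_profiles.of_isClosed_subset hcl Set.inter_subset_left using 1
  ext u
  simp only [feasible, Set.mem_ofPred_eq, Set.mem_inter_iff, Set.mem_iInter, Set.mem_preimage,
    Set.mem_Iic]
  exact ⟨fun h => ⟨h.1, fun j => ⟨h.1, h.2 j⟩⟩, fun h => ⟨h.1, fun j => (h.2 j).2⟩⟩

theorem ConstraintAssumption.convex_feasible (h2 : G.ConstraintAssumption s₀) :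
    Convex ℝ (G.feasible s₀) := by
  -- Convexity of the feasible set is read off some constraint `j`; when `m = 0` the set is all of
  -- `G.profiles`.
  rcases isEmpty_or_nonempty (Fin m) with h | ⟨⟨j⟩⟩
  · have : G.feasible s₀ = G.profiles := by
      ext u
      simp [feasible]
    rw [this]
    exact G.convex_profiles
  · exact (h2.expG_convex j).1

theorem ConstraintAssumption.differentiable_g_apply (h2 : G.ConstraintAssumption s₀) (ω : Ξ)
    (j : Fin m) : Differentiable ℝ fun u => G.g s₀ u ω j :=
  ((((h2.hat_differentiable j).comp (G.differentiable_state ω)).add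
    (h2.tilde_differentiable j)).add_const _).add_const _

theorem ConstraintAssumption.measurable_g_apply (h2 : G.ConstraintAssumption s₀)
    (u : Profile T n) (j : Fin m) : Measurable fun ω => G.g s₀ u ω j := by
  have hc : Continuous (G.xiHat j) := (h2.hat_differentiable j).continuous_real
  exact (((hc.measurable.comp (G.measurable_state s₀ u)).add_const _).add_const _).add_const _

theorem ConstraintAssumption.inner_gradient_g (h2 : G.ConstraintAssumption s₀) (i : Fin N)
    (u : Profile T n) (ω : Ξ) (j : Fin m) (e : Traj T (n i)) :
    inner ℝ (gradient (fun x : Traj T (n i) => G.g s₀ (u.deviate i x) ω j) (u i)) e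
      = fderiv ℝ (fun v => G.g s₀ v ω j) u (Profile.incl T n i e) := by
  have h := inner_gradient_comp (h2.differentiable_g_apply ω j (u.deviate i (u i)))
    (u.hasFDerivAt_deviate i (u i)) e
  rwa [Profile.deviate_self] at h

/-- Componentwise, measurability comes from limits of difference quotients and domination from the
integrable bound on the full derivative of `g`. -/
theorem integrable_gradient_g (h2 : G.ConstraintAssumption s₀) (h4 : G.RegularityAssumption s₀)
    {u : Profile T n} (hu : u ∈ G.feasible s₀) (i : Fin N) (j : Fin m) :
    Integrable (fun ω => gradient (fun x : Traj T (n i) => G.g s₀ (u.deviate i x) ω j) (u i))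
      G.ℙ := by
  obtain ⟨b, hb, hbd⟩ := h4.gradient_g_bounded
  refine integrable_of_forall_integrable_inner fun e => ?_
  simp only [h2.inner_gradient_g i u _ j e]
  refine (hb.mul_const ‖Profile.incl T n i e‖).mono' ?_ (ae_of_all _ fun ω => ?_)
  · exact aestronglyMeasurable_of_hasDerivAt
      (h := fun t ω => G.g s₀ (u + t • Profile.incl T n i e) ω j)
      (fun t _ => (h2.measurable_g_apply _ j).aestronglyMeasurable)
      (fun ω => hasDerivAt_comp_add_smul (h2.differentiable_g_apply ω j u).hasFDerivAt _)
  · have hg : DifferentiableAt ℝ (fun v => G.g s₀ v ω) u :=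
      differentiableAt_euclidean.2 fun k => h2.differentiable_g_apply ω k u
    have hj := ((PiLp.proj (𝕜 := ℝ) 2 (fun _ : Fin m => ℝ) j).hasFDerivAt.comp u
      hg.hasFDerivAt).fderiv
    have : fderiv ℝ (fun v => G.g s₀ v ω j) u (Profile.incl T n i e)
        = (fderiv ℝ (fun v => G.g s₀ v ω) u (Profile.incl T n i e)) j :=
      congrArg (fun L : Profile T n →L[ℝ] ℝ => L (Profile.incl T n i e)) hj
    rw [this]
    refine (PiLp.norm_apply_le _ j).trans ((ContinuousLinearMap.le_opNorm _ _).trans ?_)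
    exact mul_le_mul_of_nonneg_right (hbd ω u hu) (norm_nonneg _)

/-- The expected constraints have directional derivatives in the directions of the strategy
sets, given by the expected gradients. -/
theorem tendsto_slope_expG (h2 : G.ConstraintAssumption s₀) (h3 : G.ConcentrationAssumption s₀)
    (h4 : G.RegularityAssumption s₀) {u v : Profile T n} (hu : u ∈ G.feasible s₀)
    (hv : v ∈ G.profiles) (j : Fin m) :
    Tendsto (fun t : ℝ => t⁻¹ * (G.expG s₀ (u + t • (v - u)) j - G.expG s₀ u j)) (𝓝[>] 0)
      (𝓝 (∑ i, inner ℝ (G.expGradG i s₀ u j) (v i - u i))) := by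
  obtain ⟨ℓ, hℓ, hlip⟩ := h4.g_lipschitz
  have hmem : ∀ t ∈ Set.Icc (0 : ℝ) 1, u + t • (v - u) ∈ G.profiles := fun t ht =>
    G.convex_profiles.add_smul_sub_mem hu.1 hv ht
  have hd : ∀ ω, HasDerivAt (fun t : ℝ => G.g s₀ (u + t • (v - u)) ω j)
      (∑ i, inner ℝ (gradient (fun x : Traj T (n i) => G.g s₀ (u.deviate i x) ω j) (u i))
        (v i - u i)) 0 := fun ω => by
    have := hasDerivAt_comp_add_smul (h2.differentiable_g_apply ω j u).hasFDerivAt (v - u)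
    -- This splits every occurrence of `v - u` into player blocks; the next line restores those not
    -- absorbed by `map_sum`.
    rw [← Profile.sum_incl (v - u), map_sum] at this
    rw [Profile.sum_incl (v - u)] at this
    simpa only [h2.inner_gradient_g, PiLp.sub_apply] using this
  have key := (tendsto_slope_integral (P := G.ℙ)
    (h := fun t ω => G.g s₀ (u + t • (v - u)) ω j) (b := fun ω => ℓ ω * ‖v - u‖)
    (fun t ht => h3.integrable_g (hmem t ht) j) (hℓ.mul_const _)
    (fun ω t ht => by
      have h := (PiLp.norm_apply_le (G.g s₀ (u + t • (v - u)) ω - G.g s₀ u ω) j).trans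
        (hlip ω _ (hmem t (Set.Ioc_subset_Icc_self ht)) u hu.1)
      rw [add_sub_cancel_left, norm_smul, Real.norm_of_nonneg ht.1.le] at h
      simp only [zero_smul, add_zero]
      refine (le_of_eq_of_le rfl h).trans_eq (by ring)) hd).2
  have hint : ∫ ω, ∑ i, inner ℝ (gradient (fun x : Traj T (n i) => G.g s₀ (u.deviate i x) ω j)
      (u i)) (v i - u i) ∂G.ℙ = ∑ i, inner ℝ (G.expGradG i s₀ u j) (v i - u i) := by
    rw [integral_finsetSum _ fun i _ => (integrable_gradient_g h2 h4 hu i j).inner_const _]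
    refine Finset.sum_congr rfl fun i _ => ?_
    simp only [real_inner_comm (v i - u i)]
    exact integral_inner (integrable_gradient_g h2 h4 hu i j) _
  rw [hint] at key
  refine key.congr' ?_
  filter_upwards [Ioc_mem_nhdsGT (zero_lt_one' ℝ)] with t ht
  rw [h3.expG_apply (hmem t (Set.Ioc_subset_Icc_self ht)), h3.expG_apply hu.1]
  simp

/-! ### Multipliers and normal cones. -/

/-- Lagrange multipliers for the variational inequality under Slater's condition. -/
theorem exists_multipliers (h2 : G.ConstraintAssumption s₀) (h3 : G.ConcentrationAssumption s₀)
    (h4 : G.RegularityAssumption s₀) {u : Profile T n} (hu : G.IsSVISolution s₀ u) :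
    ∃ lam ∈ nonnegOrthant m, (∀ j, lam j * G.expG s₀ u j = 0) ∧ ∀ v ∈ G.profiles,
      0 ≤ inner ℝ (G.pseudoGradient s₀ u) (v - u)
        + ∑ j, lam j * ∑ i, inner ℝ (G.expGradG i s₀ u j) (v i - u i) := by
  classical
  obtain ⟨hu, hvi⟩ := hu
  have hslope := fun v (hv : v ∈ G.profiles) => tendsto_slope_expG h2 h3 h4 hu hv
  have hlin : ∀ (F : Profile T n), ConvexOn ℝ G.profiles fun v => inner ℝ F (v - u) := by
    refine fun F => ⟨G.convex_profiles, fun x _ y _ a b _ _ hab => le_of_eq ?_⟩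
    obtain rfl : b = 1 - a := by linarith
    simp only [inner_sub_right, inner_add_right, inner_smul_right, smul_eq_mul]
    ring
  -- Only the active constraints are linearized; this yields complementary slackness at the end.
  obtain ⟨c, hc0, hc⟩ := exists_multipliers_of_linearized
    (ι := {j : Fin m // G.expG s₀ u j = 0}) G.convex_profiles
    (f := fun v => inner ℝ (G.pseudoGradient s₀ u) (v - u)) (hlin _)
    (a := fun j v => ∑ i, inner ℝ (G.expGradG i s₀ u j) (v i - u i))
    (fun j => by
      have := hlin (WithLp.toLp 2 fun i => G.expGradG i s₀ u j)
      simp only [Profile.inner_eq_sum] at this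
      exact this)
    -- Along `v - u` an active constraint becomes negative because its slope is, and an inactive one
    -- stays negative for small `t`. So `u + t (v - u)` is feasible and tests the variational
    -- inequality.
    (fun v hv hneg => by
      have hev : ∀ j, ∀ᶠ t in 𝓝[>] (0 : ℝ), G.expG s₀ (u + t • (v - u)) j ≤ 0 := by
        intro j
        by_cases hj : G.expG s₀ u j = 0
        · filter_upwards [(hslope v hv j).eventually_lt_const (hneg ⟨j, hj⟩),
            self_mem_nhdsWithin] with t ht ht0
          rw [hj, sub_zero] at ht
          exact (neg_of_mul_neg_right ht (inv_nonneg.2 (le_of_lt ht0))).le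
        · have hneg' : G.expG s₀ u j < 0 := lt_of_le_of_ne (hu.2 j) hj
          have hid : Tendsto (fun t : ℝ => t) (𝓝[>] 0) (𝓝 0) := nhdsWithin_le_nhds
          have hlim := hid.mul (hslope v hv j)
          rw [zero_mul] at hlim
          filter_upwards [hlim.eventually_lt_const (neg_pos.2 hneg'), self_mem_nhdsWithin]
            with t ht ht0
          rw [mul_inv_cancel_left₀ (ne_of_gt ht0)] at ht
          linarith
      have hall := (eventually_all.2 hev).and
        ((G.convex_profiles.eventually_add_smul_sub_mem hu.1 hv).and self_mem_nhdsWithin)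
      obtain ⟨t, ht, htp, ht0⟩ := hall.exists
      have := hvi _ ⟨htp, ht⟩
      rw [add_sub_cancel_left, inner_smul_right] at this
      exact nonneg_of_mul_nonneg_right this ht0)
    -- By convexity the slope of an active constraint towards Slater's point is at most its value
    -- there, which is negative.
    (by
      obtain ⟨w, hw, hwneg⟩ := h4.slater
      refine ⟨w, hw, fun j => ?_⟩
      have := (h2.expG_convex j).le_sub_of_tendsto_slope hu ⟨hw, fun j => (hwneg j).le⟩
        (hslope w hw j)
      rw [j.2, sub_zero] at this
      exact this.trans_lt (hwneg j))
  refine ⟨WithLp.toLp 2 fun j => if h : G.expG s₀ u j = 0 then c ⟨j, h⟩ else 0, fun j => ?_,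
    fun j => ?_, fun v hv => ?_⟩
  · by_cases h : G.expG s₀ u j = 0 <;> simp [h, hc0]
  · by_cases h : G.expG s₀ u j = 0 <;> simp [h]
  · refine (hc v hv).trans_eq ?_
    congr 1
    rw [← Fintype.sum_subtype_add_sum_subtype fun j => G.expG s₀ u j = 0]
    refine (add_zero _).symm.trans (congrArg₂ _ ?_ (Finset.sum_eq_zero fun j _ => ?_).symm)
    · exact Finset.sum_congr rfl fun j _ => by dsimp only; rw [dif_pos j.2]
    · dsimp only
      rw [dif_neg j.2, zero_mul]

theorem expGradGMul_eq (i : Fin N) (u : Profile T n) (lam : Vec m) :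
    G.expGradGMul i s₀ u lam = ∑ j, lam j • G.expGradG i s₀ u j := rfl

theorem mem_normalConeAt_nonnegOrthant {lam x : Vec m} (hlam : lam ∈ nonnegOrthant m)
    (hx : ∀ j, x j ≤ 0) (hcomp : ∀ j, lam j * x j = 0) :
    x ∈ normalConeAt (nonnegOrthant m) lam := by
  refine ⟨hlam, fun y hy => ?_⟩
  rw [PiLp.inner_apply]
  refine Finset.sum_nonpos fun j _ => ?_
  have := mul_nonpos_of_nonneg_of_nonpos (hy j) (hx j)
  have := hcomp j
  simp only [PiLp.sub_apply, RCLike.inner_apply, conj_trivial]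
  nlinarith

/-- The strategy sets form a product, so testing against deviations of player `i` alone isolates
that block. -/
theorem apply_mem_normalConeAt_strategies {u v : Profile T n}
    (hv : v ∈ normalConeAt G.profiles u) (i : Fin N) :
    v i ∈ normalConeAt (G.strategies i) (u i) := by
  refine ⟨hv.1 i, fun y hy => ?_⟩
  have := hv.2 _ (G.deviate_mem_profiles hv.1 hy)
  rw [Profile.inner_eq_sum, Finset.sum_eq_single i] at this
  · simpa using this
  · intro k _ hk
    simp [Profile.deviate_of_ne u hk]
  · simp

end DynGame

end FirstOrder

end

theorem mainTheorem4 {N T ns m : ℕ} {n : Fin N → ℕ} {Ξ : Type*} [MeasurableSpace Ξ]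
    (G : DynGame N T ns m n Ξ) (s₀ : Vec ns)
    (h1 : G.CostAssumption s₀) (h2 : G.ConstraintAssumption s₀)
    (h3 : G.ConcentrationAssumption s₀) (h4 : G.RegularityAssumption s₀) :
    (zer (G.opA s₀ + G.opB)).Nonempty ∧
      ∃ u lam, (u, lam) ∈ zer (G.opA s₀ + G.opB) ∧ G.IsVariationalSGNE s₀ u ∧
        lam ∈ nonnegOrthant m ∧ G.IsKKT s₀ u lam := by
  obtain ⟨w, hw, hwneg⟩ := h4.slater
  obtain ⟨u, hu⟩ := h1.exists_isSVISolution (DynGame.isCompact_feasible h3 h4) h2.convex_feasible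
    ⟨w, hw, fun j => (hwneg j).le⟩
  obtain ⟨lam, hlam, hcomp, hmul⟩ := DynGame.exists_multipliers h2 h3 h4 hu
  have hdual : G.expG s₀ u ∈ normalConeAt (nonnegOrthant m) lam :=
    DynGame.mem_normalConeAt_nonnegOrthant hlam hu.1.2 hcomp
  -- The primal component of the operator `G.opA s₀` at `(u, lam)`; the multiplier inequality says
  -- exactly that `-z` is normal to the profiles.
  let z : Profile T n :=
    G.pseudoGradient s₀ u + WithLp.toLp 2 fun i => G.expGradGMul i s₀ u lam
  have hprimal : -z ∈ normalConeAt G.profiles u := by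
    refine ⟨hu.1.1, fun v hv => ?_⟩
    have h := hmul v hv
    rw [inner_neg_left, neg_nonpos, inner_add_left]
    refine h.trans_eq ?_
    congr 1
    rw [Profile.inner_eq_sum]
    simp only [DynGame.expGradGMul_eq, sum_inner, real_inner_smul_left, Finset.mul_sum]
    rw [Finset.sum_comm]
    rfl
  have hzer : (u, lam) ∈ zer (G.opA s₀ + G.opB) := by
    refine Set.mem_add.2 ⟨_, rfl, (-z, G.expG s₀ u), ⟨hprimal, hdual⟩, ?_⟩
    ext1
    · simp [z]
    · simp
  refine ⟨⟨_, hzer⟩, u, lam, hzer, h1.isVariationalSGNE hu, hlam, fun i => ?_, ?_⟩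
  · refine Set.mem_add.2 ⟨_, Set.mem_add.2 ⟨_, rfl, _,
      DynGame.apply_mem_normalConeAt_strategies hprimal i, rfl⟩, _, rfl, ?_⟩
    simp only [z, PiLp.neg_apply, PiLp.add_apply, DynGame.pseudoGradient]
    abel
  · exact Set.mem_add.2 ⟨_, rfl, _, hdual, by simp⟩
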